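/- Let $q\in[0,1)$. Trees. Let $\mathbb T$ be the set of finite words on $\{\mathbf 0,\mathbf 1\}$. A binary tree is a prefix-closed subset of $\mathbb T$. Add a letter $\Upsilon$ and write $\mathbf 1^k=\Upsilon^{|k|}$ for $k<0$; let $\mathbb Y=\bigcup_{k\in\mathbb Z}\{\mathbf 1^k\}\cup\mathbf 1^k\mathbf 0\mathbb T$. The binary search tree of a finite sequence $x=(x_1,\dots,x_n)$ of distinct numbers is $T\langle x\rangle=\emptyset$ if $n=0$, and otherwise $T\langle x\rangle=\{\emptyset\}\cup\mathbf 0\,T\langle x_-\rangle\cup\mathbf 1\,T\langle x_+\rangle$ (here the element $\emptyset$ is the empty word), where $x_-$ and $x_+$ are the subsequences of the terms smaller, respectively larger, than $x_1$. Mallows permutations. For $n\ge 0$, let $\pi_{n,q}$ be the distribution on the permutations of $\{1,\dots,n\}$ with $\pi_{n,q}(\sigma)\propto q^{\mathrm{Inv}(\sigma)}$, where $\mathrm{Inv}(\sigma)=|\{i<j:\sigma(i)>\sigma(j)\}|$ and $0^0=1$. A permutation $\sigma$ of $\mathbb Z$ is balanced if $|\{i>0:\sigma(i)\le 0\}|=|\{i\le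 0:\sigma(i)>0\}|<\infty$. A two-sided infinite Mallows permutation $\mathcal X_q$ is a random permutation of $\mathbb Z$ that is almost surely balanced and whose law is $q$-invariant: for every $i\in\mathbb Z$ and every measurable set $A$ of functions $f:\mathbb Z\to\mathbb Z$ with $f(i)<f(i+1)$, one has $\mathbb P(\mathcal X_q\circ(i\ i{+}1)\in A)=q\,\mathbb P(\mathcal X_q\in A)$. Redwood trees. A record index of a permutation $\sigma$ of $\mathbb Z$ is an index $r$ with $\sigma(j)<\sigma(r)$ for all $j<r$. If $\sigma$ is balanced, its record indices can be uniquely enumerated in increasing order as $(r_k)_{k\in\mathbb Z}$ with $\sigma(r_0)\le 0<\sigma(r_1)$. Let $\sigma[k]$ be the sequence of the values $\sigma(i)$ with $\sigma(r_k)<\sigma(i)<\sigma(r_{k+1})$, in increasing order of $i$. The redwood tree of $\sigma$ is $\bigcup_{k\in\mathbb Z}\{\mathbf 1^k\}\cup\mathbf 1^k\mathbf 0\,T\langle\sigma[k]\rangle\subseteq\mathbb Y$. Theorem. Let $Y_q$ be the redwood tree of a two-sided infinite Mallows permutation with parameter $q$, and for $k\in\mathbb Z$ let $Y_q(k)=Y_q\cap\mathbf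 1^k\mathbf 0\mathbb T$ be the left subtree of the node $\mathbf 1^k$. Then: (i) the random sets $(Y_q(k))_{k\in\mathbb Z}$ are independent; (ii) for $k\ne 0$ and $n\ge 0$, $\mathbb P(|Y_q(k)|=n)=q^n(1-q)$, while $\mathbb P(|Y_q(0)|=n)=(n+1)q^n(1-q)^2$; (iii) for all $k\in\mathbb Z$ and $n\ge 0$ with $\mathbb P(|Y_q(k)|=n)>0$, and every binary tree $t$ with $n$ nodes, $\mathbb P\big(Y_q(k)=\mathbf 1^k\mathbf 0\,t\,\big|\,|Y_q(k)|=n\big)=\mathbb P\big(T\langle X_n\rangle=t\big)$, where $X_n$ is $\pi_{n,q}$-distributed. Conversely, any random subset $Y$ of $\mathbb Y$ that almost surely contains all the nodes $\mathbf 1^k$, $k\in\mathbb Z$, and satisfies (i), (ii) and (iii) has the same distribution as $Y_q$. -/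

import Mathlib

open MeasureTheory ProbabilityTheory

namespace RedwoodMallows

/-! ### Words and trees -/

/-- The alphabet `{𝟎, 𝟏, Υ}`; the letter `up` is the symbol `Υ` standing for `𝟏⁻¹`. -/
inductive Letter : Type
  | zero
  | one
  | up
deriving DecidableEq

/-- Words on the alphabet `{𝟎, 𝟏, Υ}`; the empty word is the root. -/
abbrev Word : Type := List Letter

/-- The powers `𝟏ᵏ`, `k ∈ ℤ`, with the convention `𝟏ᵏ = Υ^|k|` for `k < 0`. -/
def onePow : ℤ → Word
  | Int.ofNat m => List.replicate m Letter.one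
  | Int.negSucc m => List.replicate (m + 1) Letter.up

/-- The infinite binary tree `𝕋`: all words on `{𝟎, 𝟏}`. -/
def binTree : Set Word := {w | Letter.up ∉ w}

/-- Binary trees: subsets of `𝕋` that are stable under taking prefixes (possibly empty). -/
def IsBinaryTree (T : Set Word) : Prop :=
  T ⊆ binTree ∧ ∀ u v : Word, u ++ v ∈ T → u ∈ T

/-- For a set `T` of words, the set `𝟏ᵏ𝟎T`. -/
def hangLeft (k : ℤ) (T : Set Word) : Set Word :=
  (fun w : Word => onePow k ++ Letter.zero :: w) '' T

/-- The extended binary tree `𝕐 = ⋃_{k ∈ ℤ} {𝟏ᵏ} ∪ 𝟏ᵏ𝟎𝕋`. -/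
def extTree : Set Word := ⋃ k : ℤ, {onePow k} ∪ hangLeft k binTree

/-- The left subtree `Y(k) = Y ∩ 𝟏ᵏ𝟎𝕋` of the node `𝟏ᵏ` in `Y`. -/
def leftSubtree (Y : Set Word) (k : ℤ) : Set Word := Y ∩ hangLeft k binTree

/-- The binary search tree of a finite sequence (of distinct values): empty for the empty
sequence, and `{∅} ∪ 𝟎 bst(x₋) ∪ 𝟏 bst(x₊)` otherwise. -/
def bst : List ℤ → Finset Word
  | [] => ∅
  | a :: l =>
      {[]} ∪ (bst (l.filter fun b => b < a)).image (List.cons Letter.zero)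
        ∪ (bst (l.filter fun b => a < b)).image (List.cons Letter.one)
termination_by l => l.length
decreasing_by
  all_goals
    simp only [List.length_unattach, List.length_cons]
    exact Nat.lt_succ_of_le ((List.length_filter_le _ l.attach).trans (by simp))

/-! ### Redwood trees -/

/-- `i` is a record index of `σ`. -/
def IsRecordIndex (σ : Equiv.Perm ℤ) (i : ℤ) : Prop := ∀ j < i, σ j < σ i

/-- `r` is the standard record representation of `σ`: the increasing enumeration of all record
indices such that `σ (r 0) ≤ 0 < σ (r 1)`. -/
def IsStdRecordRep (σ : Equiv.Perm ℤ) (r : ℤ → ℤ) : Prop :=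
  StrictMono r ∧ Set.range r = {i | IsRecordIndex σ i} ∧ σ (r 0) ≤ 0 ∧ 0 < σ (r 1)

open Classical in
/-- The standard record representation of `σ`. It exists when `σ` is admissible, and is unique;
the value is irrelevant when it does not exist. -/
noncomputable def stdRecord (σ : Equiv.Perm ℤ) : ℤ → ℤ :=
  if h : ∃ r, IsStdRecordRep σ r then h.choose else id

/-- The sequence of all images `σ i` with `a < σ i < b`, listed by increasing index `i`. -/
noncomputable def wordBetween (σ : Equiv.Perm ℤ) (a b : ℤ) : List ℤ :=
  (((Finset.Ioo a b).image σ.symm).sort (· ≤ ·)).map σ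

/-- The sequence `σ[k]` of images of `σ` strictly between the records `σ (r k)` and
`σ (r (k + 1))`. -/
noncomputable def recordWord (σ : Equiv.Perm ℤ) (k : ℤ) : List ℤ :=
  wordBetween σ (σ (stdRecord σ k)) (σ (stdRecord σ (k + 1)))

/-- The redwood tree of `σ`: `⋃_{k ∈ ℤ} {𝟏ᵏ} ∪ 𝟏ᵏ𝟎 bst(σ[k])`. -/
noncomputable def redwood (σ : Equiv.Perm ℤ) : Set Word :=
  ⋃ k : ℤ, {onePow k} ∪ hangLeft k (bst (recordWord σ k) : Set Word)

/-! ### Mallows permutations -/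

/-- The number of inversions of a finite permutation. -/
def inversions {n : ℕ} (σ : Equiv.Perm (Fin n)) : ℕ :=
  (Finset.univ.filter fun p : Fin n × Fin n => p.1 < p.2 ∧ σ p.2 < σ p.1).card

/-- The Mallows distribution `π_{n,q}` on the permutations of `n` elements. -/
noncomputable def mallowsProb (q : ℝ) {n : ℕ} (σ : Equiv.Perm (Fin n)) : ℝ :=
  q ^ inversions σ / ∑ τ : Equiv.Perm (Fin n), q ^ inversions τ

/-- The sequence `(σ(1), …, σ(n))` of a permutation of `{1, …, n}`. -/
def permWord {n : ℕ} (σ : Equiv.Perm (Fin n)) : List ℤ :=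
  List.ofFn fun i => ((σ i : ℕ) : ℤ) + 1

/-- The probability that the binary search tree of a `π_{n,q}`-distributed permutation is `t`. -/
noncomputable def mallowsTreeProb (q : ℝ) (n : ℕ) (t : Finset Word) : ℝ :=
  ∑ σ : Equiv.Perm (Fin n) with bst (permWord σ) = t, mallowsProb q σ

/-- A permutation of `ℤ` is admissible if only finitely many integers change sides of the cut
between `0` and `1`. -/
def IsAdmissible (σ : Equiv.Perm ℤ) : Prop :=
  {i : ℤ | 0 < i ∧ σ i ≤ 0}.Finite ∧ {i : ℤ | i ≤ 0 ∧ 0 < σ i}.Finite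

/-- A permutation of `ℤ` is balanced if it is admissible and as many integers cross the cut
between `0` and `1` downwards as upwards. -/
def IsBalanced (σ : Equiv.Perm ℤ) : Prop :=
  IsAdmissible σ ∧ {i : ℤ | 0 < i ∧ σ i ≤ 0}.ncard = {i : ℤ | i ≤ 0 ∧ 0 < σ i}.ncard

/-- A two-sided infinite Mallows permutation with parameter `q`: a random balanced permutation of
`ℤ` whose law is `q`-invariant, that is, exchanging the images of `i` and `i + 1` multiplies the
probability by `q` wherever those images were in increasing order. -/
structure IsMallowsPermutation {Ω : Type*} [MeasurableSpace Ω] (q : ℝ) (P : Measure Ω)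
    (X : Ω → Equiv.Perm ℤ) : Prop where
  measurable : ∀ i : ℤ, Measurable fun ω => X ω i
  balanced : ∀ᵐ ω ∂P, IsBalanced (X ω)
  q_invariant : ∀ (i : ℤ) (A : Set (ℤ → ℤ)), MeasurableSet A → (∀ f ∈ A, f i < f (i + 1)) →
    P {ω | (fun j => (X ω * Equiv.swap i (i + 1)) j) ∈ A} =
      ENNReal.ofReal q * P {ω | (fun j => X ω j) ∈ A}

/-! ### The law of the redwood Mallows tree -/

/-- The mass function on `{0, 1, …}` of the geometric distribution `Geom₀(p)`. -/
def geomMass (p : ℝ) (n : ℕ) : ℝ := (1 - p) ^ n * p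

/-- The mass function on `{0, 1, …}` of the size-biased version of `Geom₀(p)` minus one. -/
def sbGeomMass (p : ℝ) (n : ℕ) : ℝ := (n + 1) * (1 - p) ^ n * p ^ 2

/-- `Y` is a random subset of `𝕐` that contains the whole spine `{𝟏ᵏ : k ∈ ℤ}` and whose left
subtrees `Y(k)` are independent Mallows trees with parameter `q`, of size `Geom₀(1 - q)` for
`k ≠ 0` and of size-biased geometric size minus one for `k = 0`. -/
structure IsMallowsSpineTree {Ω : Type*} [MeasurableSpace Ω] (q : ℝ) (P : Measure Ω)
    (Y : Ω → Set Word) : Prop where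
  aemeasurable : AEMeasurable Y P
  subset_extTree : ∀ᵐ ω ∂P, Y ω ⊆ extTree
  spine_mem : ∀ᵐ ω ∂P, ∀ k : ℤ, onePow k ∈ Y ω
  indep : iIndepFun (fun (k : ℤ) (ω : Ω) => leftSubtree (Y ω) k) P
  size_of_ne_zero : ∀ k : ℤ, k ≠ 0 → ∀ n : ℕ,
    P {ω | (leftSubtree (Y ω) k).encard = n} = ENNReal.ofReal (geomMass (1 - q) n)
  size_zero : ∀ n : ℕ,
    P {ω | (leftSubtree (Y ω) 0).encard = n} = ENNReal.ofReal (sbGeomMass (1 - q) n)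
  cond_size : ∀ (k : ℤ) (n : ℕ) (t : Finset Word), IsBinaryTree (t : Set Word) → t.card = n →
    P {ω | (leftSubtree (Y ω) k).encard = n} ≠ 0 →
    P[{ω | leftSubtree (Y ω) k = hangLeft k (t : Set Word)} |
        {ω | (leftSubtree (Y ω) k).encard = n}] = ENNReal.ofReal (mallowsTreeProb q n t)

end RedwoodMallows

namespace RedwoodMallows

/-! ### Words, subtrees and spines -/

/-! The redwood tree is read off from the record values of `σ` (those with all larger values to
their right) and the words between consecutive ones.

The engine is `IsMallowsLaw.measure_swap_mul`. Invariance is assumed for adjacent positions, but it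
extends to exchanging two values `x < y` with `x` on the left, whenever no intermediate value stands
between them: exactly one inversion is created. This has two consequences.

Exchange `v` with the first larger value to its right. The number of larger values left of `v` grows
by one, and the relative order of the larger values is unchanged. That number, almost surely finite,
is therefore geometric and independent of that order. So `v` is a record with probability `1 - q`,
independently of the records above it: the record values form a Bernoulli process
(`IsMallowsLaw.measureReal_recordsAgree`).

Next, if there is no record strictly between `a` and a record `b > a`, then `b` precedes all the
values in between, and conversely. Hence the record pattern, together with the trees of the other
gaps, is unaffected by permuting the values of one gap. Exchanging neighbours in the word of that
gap multiplies the probability by `q`, so the word is Mallows distributed and independent of the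
rest (`IsMallowsLaw.measureReal_recordsAgree_inter_bst`).

Prescribing the trees `t k` in a window of gaps around the cut fixes the spacings of the record
values. Only the largest non-positive record `-j` is free, with `0 ≤ j ≤ |t 0|`. All these positions
have the same probability, so summing over them gives the size bias, at `k = 0` only
(`IsMallowsLaw.recordTree_joint`).

For the converse, the prescribed probabilities of the countably many finite trees sum to one, so
they determine the law of each `Y(k)`. Independence gives the joint law, and the spine with the left
subtrees rebuilds `Y` (`IsMallowsSpineTree.map_eq`). -/

theorem zero_notMem_onePow (k : ℤ) : Letter.zero ∉ onePow k := by
  cases k <;> simp [onePow, List.mem_replicate]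

theorem onePow_injective : Function.Injective onePow := by
  intro k l h
  cases k with
  | ofNat m =>
    cases l with
    | ofNat n =>
      have := congrArg List.length h
      simp only [onePow, List.length_replicate] at this
      rw [this]
    | negSucc n =>
      have := congrArg (List.count Letter.up) h
      simp [onePow, List.count_replicate] at this
  | negSucc m =>
    cases l with
    | ofNat n =>
      have := congrArg (List.count Letter.up) h
      simp [onePow, List.count_replicate] at this
    | negSucc n =>
      have := congrArg List.length h
      simp only [onePow, List.length_replicate, Nat.add_right_cancel_iff] at this
      rw [this]

/-- The spine part of a word is what precedes its first `𝟎`, so `takeWhile` recovers it. -/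
theorem onePow_append_inj {k l : ℤ} {u v : Word}
    (h : onePow k ++ Letter.zero :: u = onePow l ++ Letter.zero :: v) : k = l ∧ u = v := by
  have key : ∀ (j : ℤ) (w : Word),
      (onePow j ++ Letter.zero :: w).takeWhile (fun a => decide (a ≠ Letter.zero)) = onePow j := by
    intro j w
    rw [List.takeWhile_append_of_pos]
    · simp
    · intro a ha
      simp only [ne_eq, decide_eq_true_eq]
      rintro rfl
      exact zero_notMem_onePow j ha
  have hk := key k u
  rw [h, key l v] at hk
  obtain rfl := onePow_injective hk
  exact ⟨rfl, by simpa using h⟩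

theorem onePow_append_injective (k : ℤ) :
    Function.Injective fun w : Word => onePow k ++ Letter.zero :: w :=
  fun _ _ h => (onePow_append_inj h).2

theorem hangLeft_injective (k : ℤ) : Function.Injective (hangLeft k) :=
  (onePow_append_injective k).image_injective

theorem encard_hangLeft (k : ℤ) (T : Set Word) : (hangLeft k T).encard = T.encard :=
  (onePow_append_injective k).encard_image T

theorem onePow_notMem_hangLeft (k l : ℤ) (T : Set Word) : onePow k ∉ hangLeft l T := by
  rintro ⟨w, -, h⟩
  apply zero_notMem_onePow k
  rw [← h]
  simp

theorem leftSubtree_iUnion {T : ℤ → Set Word} (hT : ∀ k, T k ⊆ binTree) (k : ℤ) :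
    leftSubtree (⋃ l : ℤ, {onePow l} ∪ hangLeft l (T l)) k = hangLeft k (T k) := by
  ext w
  simp only [leftSubtree, Set.mem_inter_iff, Set.mem_iUnion, Set.mem_union, Set.mem_singleton_iff]
  constructor
  · rintro ⟨⟨l, rfl | ⟨u, hu, rfl⟩⟩, hw⟩
    · exact absurd hw (onePow_notMem_hangLeft _ _ _)
    · obtain ⟨v, hv, h⟩ := hw
      obtain ⟨rfl, rfl⟩ := onePow_append_inj h
      exact ⟨_, hu, rfl⟩
  · intro hw
    refine ⟨⟨k, Or.inr hw⟩, ?_⟩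
    obtain ⟨u, hu, rfl⟩ := hw
    exact ⟨u, hT k hu, rfl⟩

/-- Reduces the law of a spine tree to the joint law of its left subtrees. -/
theorem eq_iUnion_leftSubtree {Y : Set Word} (h : Y ⊆ extTree) (hs : ∀ k, onePow k ∈ Y) :
    Y = ⋃ k : ℤ, {onePow k} ∪ leftSubtree Y k := by
  ext w
  simp only [Set.mem_iUnion, Set.mem_union, Set.mem_singleton_iff]
  constructor
  · intro hw
    obtain ⟨k, hk⟩ := Set.mem_iUnion.1 (h hw)
    exact ⟨k, hk.imp id fun h' => ⟨hw, h'⟩⟩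
  · rintro ⟨k, rfl | hw⟩
    · exact hs k
    · exact hw.1

/-- Makes words, and finite sets of words, countable; the measurability arguments on trees rest on
this. -/
instance : Finite Letter :=
  Finite.of_injective
    (fun a : Letter => match a with
      | Letter.zero => (0 : Fin 3)
      | Letter.one => 1
      | Letter.up => 2)
    (by intro a b; cases a <;> cases b <;> simp)

/-! ### Binary search trees -/

theorem mem_bst_cons {a : ℤ} {l : List ℤ} {w : Word} :
    w ∈ bst (a :: l) ↔ w = [] ∨
      (∃ u ∈ bst (l.filter fun b => b < a), Letter.zero :: u = w) ∨
      (∃ u ∈ bst (l.filter fun b => a < b), Letter.one :: u = w) := by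
  rw [bst]
  simp

/-- Induction along the recursive definition of the binary search tree. -/
theorem bst_induction {C : List ℤ → Prop} (nil : C [])
    (cons : ∀ a l, C (l.filter fun b => b < a) → C (l.filter fun b => a < b) → C (a :: l))
    (l : List ℤ) : C l := by
  induction hn : l.length using Nat.strong_induction_on generalizing l with
  | _ n ih =>
    cases l with
    | nil => exact nil
    | cons a l =>
      have hlt : ∀ p : ℤ → Bool, (l.filter p).length < n := fun p => by
        have := List.length_filter_le p l
        simp only [List.length_cons] at hn
        omega
      exact cons a l (ih _ (hlt _) _ rfl) (ih _ (hlt _) _ rfl)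

theorem isBinaryTree_bst (l : List ℤ) : IsBinaryTree (bst l : Set Word) := by
  induction l using bst_induction with
  | nil => simp [bst, IsBinaryTree]
  | cons a l h₀ h₁ =>
    refine ⟨fun w hw => ?_, fun u v huv => ?_⟩
    · rw [Finset.mem_coe, mem_bst_cons] at hw
      obtain rfl | ⟨u, hu, rfl⟩ | ⟨u, hu, rfl⟩ := hw
      · simp [binTree]
      · simpa [binTree] using h₀.1 hu
      · simpa [binTree] using h₁.1 hu
    · rw [Finset.mem_coe, mem_bst_cons] at huv ⊢
      cases u with
      | nil => exact Or.inl rfl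
      | cons b u =>
        obtain h | ⟨w, hw, h⟩ | ⟨w, hw, h⟩ := huv
        · simp at h
        · simp only [List.cons_append, List.cons.injEq] at h
          obtain ⟨rfl, rfl⟩ := h
          exact Or.inr (Or.inl ⟨u, h₀.2 _ _ hw, rfl⟩)
        · simp only [List.cons_append, List.cons.injEq] at h
          obtain ⟨rfl, rfl⟩ := h
          exact Or.inr (Or.inr ⟨u, h₁.2 _ _ hw, rfl⟩)

theorem card_bst {l : List ℤ} (hl : l.Nodup) : (bst l).card = l.length := by
  induction l using bst_induction with
  | nil => simp [bst]
  | cons a l h₀ h₁ =>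
    obtain ⟨ha, hl⟩ := List.nodup_cons.1 hl
    have e : (l.filter fun b => a < b).length = (l.filter fun b => !decide (b < a)).length := by
      congr 1
      apply List.filter_congr
      intro b hb
      have : b ≠ a := fun h => ha (h ▸ hb)
      simp only [← decide_not, decide_eq_decide]
      omega
    rw [bst, Finset.card_union_of_disjoint, Finset.card_union_of_disjoint,
      Finset.card_image_of_injective _ List.cons_injective,
      Finset.card_image_of_injective _ List.cons_injective, h₀ (hl.filter _), h₁ (hl.filter _), e,
      Finset.card_singleton, List.length_cons,
      List.length_eq_length_filter_add (l := l) fun b => decide (b < a)]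
    · ring
    · simp
    · rw [Finset.disjoint_left]
      intro w hw hw'
      simp only [Finset.mem_union, Finset.mem_singleton, Finset.mem_image] at hw hw'
      obtain ⟨u, -, rfl⟩ := hw'
      simp at hw

/-- Only comparisons enter the construction; this is what allows a word between two records to be
translated to `1, …, n`. -/
theorem bst_map {φ : ℤ → ℤ} (hφ : StrictMono φ) (l : List ℤ) : bst (l.map φ) = bst l := by
  induction l using bst_induction with
  | nil => rfl
  | cons a l h₀ h₁ =>
    rw [List.map_cons, bst, bst, List.filter_map, List.filter_map]
    simp only [Function.comp_def, hφ.lt_iff_lt]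
    rw [h₀, h₁]

theorem leftSubtree_redwood (σ : Equiv.Perm ℤ) (k : ℤ) :
    leftSubtree (redwood σ) k = hangLeft k (bst (recordWord σ k) : Set Word) :=
  leftSubtree_iUnion (fun l => (isBinaryTree_bst (recordWord σ l)).1) k

/-! ### The words between two values -/

/-- A list is determined by its entries once their order by position is prescribed, so the word can
be identified without handling the sort. -/
theorem wordBetween_eq_iff {σ : Equiv.Perm ℤ} {a b : ℤ} {w : List ℤ} :
    wordBetween σ a b = w ↔
      (∀ u, u ∈ w ↔ a < u ∧ u < b) ∧ w.Pairwise fun x y => σ.symm x < σ.symm y := by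
  have h₁ : ∀ u, u ∈ wordBetween σ a b ↔ a < u ∧ u < b := by
    intro u
    simp [wordBetween]
  have h₂ : (wordBetween σ a b).Pairwise fun x y => σ.symm x < σ.symm y := by
    rw [wordBetween, List.pairwise_map]
    simpa using (Finset.sortedLT_sort ((Finset.Ioo a b).image σ.symm)).pairwise
  constructor
  · rintro rfl
    exact ⟨h₁, h₂⟩
  · rintro ⟨hw, hw'⟩
    have irr : ∀ l : List ℤ, l.Pairwise (fun x y => σ.symm x < σ.symm y) → l.Nodup := fun l hl =>
      hl.imp fun {x y} h => by rintro rfl; exact lt_irrefl _ h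
    have hperm : (wordBetween σ a b).Perm w :=
      (List.perm_ext_iff_of_nodup (irr _ h₂) (irr _ hw')).2 fun u => (h₁ u).trans (hw u).symm
    exact hperm.eq_of_pairwise (fun x y _ _ h h' => absurd h (lt_asymm h')) h₂ hw'

theorem nodup_wordBetween (σ : Equiv.Perm ℤ) (a b : ℤ) : (wordBetween σ a b).Nodup :=
  ((wordBetween_eq_iff.1 rfl).2).imp fun {x y} h => by rintro rfl; exact lt_irrefl _ h

theorem length_wordBetween (σ : Equiv.Perm ℤ) (a b : ℤ) :
    (wordBetween σ a b).length = (b - a - 1).toNat := by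
  rw [← List.toFinset_card_of_nodup (nodup_wordBetween σ a b), ← Int.card_Ioo]
  congr 1
  ext u
  rw [List.mem_toFinset, (wordBetween_eq_iff.1 (rfl : wordBetween σ a b = _)).1, Finset.mem_Ioo]

/-! ### Record values -/

/-- `u` is a record value of `σ`: all the larger values stand to its right. -/
def IsRecordValue (σ : Equiv.Perm ℤ) (u : ℤ) : Prop := ∀ v > u, σ.symm u < σ.symm v

/-- Records are handled through their values from here on: the gaps between record values carry the
tree sizes, and the exchanges used below act on values. -/
theorem isRecordValue_apply_iff {σ : Equiv.Perm ℤ} {i : ℤ} :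
    IsRecordValue σ (σ i) ↔ IsRecordIndex σ i := by
  constructor
  · intro h j hj
    by_contra! hlt
    have hne : σ i ≠ σ j := fun e => hj.ne' (σ.injective e)
    have := h (σ j) (lt_of_le_of_ne hlt hne)
    simp only [Equiv.symm_apply_apply] at this
    omega
  · intro h v hv
    rw [Equiv.symm_apply_apply]
    by_contra! hle
    have hne : σ.symm v ≠ i := by
      rintro rfl
      simp at hv
    have := h _ (lt_of_le_of_ne hle hne)
    simp at this
    omega

/-- Such a `j` crosses the cut upwards, or lies in `[1, i]`, or has its image in `[v, 0]`: three
finite sets. -/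
theorem IsAdmissible.finite_left {σ : Equiv.Perm ℤ} (h : IsAdmissible σ) (i v : ℤ) :
    {j | j ≤ i ∧ v < σ j}.Finite := by
  refine ((h.2.union (Set.finite_Icc 1 i)).union
    ((Set.finite_Icc v 0).image σ.symm)).subset fun j hj => ?_
  simp only [Set.mem_ofPred_eq] at hj
  simp only [Set.mem_union, Set.mem_ofPred_eq, Set.mem_Icc, Set.mem_image]
  by_cases h₁ : 0 < σ j
  · by_cases h₂ : j ≤ 0
    · exact Or.inl (Or.inl ⟨h₂, h₁⟩)
    · exact Or.inl (Or.inr ⟨by omega, hj.1⟩)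
  · exact Or.inr ⟨σ j, ⟨by omega, by omega⟩, by simp⟩

theorem IsAdmissible.finite_greater_left {σ : Equiv.Perm ℤ} (h : IsAdmissible σ) (v : ℤ) :
    {u | v < u ∧ σ.symm u < σ.symm v}.Finite := by
  refine ((h.finite_left (σ.symm v) v).image σ).subset fun u hu => ?_
  exact ⟨σ.symm u, ⟨hu.2.le, by simpa using hu.1⟩, by simp⟩

/-- To the left of any index there is a record index. -/
theorem IsAdmissible.exists_isRecordIndex_le {σ : Equiv.Perm ℤ} (h : IsAdmissible σ) (i : ℤ) :
    ∃ j ≤ i, IsRecordIndex σ j := by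
  have hfin : (σ '' {j | j ≤ i ∧ σ i - 1 < σ j}).Finite := (h.finite_left i (σ i - 1)).image σ
  -- The largest image at the positions up to `i` is a record; only the finitely many images that
  -- are at least `σ i` compete for it.
  obtain ⟨u, ⟨⟨j, hj, rfl⟩, hmax⟩⟩ := hfin.exists_maximal ⟨_, i, ⟨le_rfl, by omega⟩, rfl⟩
  refine ⟨j, hj.1, fun l hl => ?_⟩
  by_contra! hlt
  have := hmax ⟨l, ⟨by have := hj.1; omega, by have := hj.2; omega⟩, rfl⟩ hlt
  exact hl.ne (σ.injective (le_antisymm this hlt))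

/-- Above any value there is a record value. -/
theorem IsAdmissible.exists_le_isRecordValue {σ : Equiv.Perm ℤ} (h : IsAdmissible σ) (v : ℤ) :
    ∃ u ≥ v, IsRecordValue σ u := by
  have hfin : {j | j ≤ σ.symm v ∧ v - 1 < σ j}.Finite := h.finite_left _ _
  -- The leftmost position whose image is at least `v` carries a record.
  obtain ⟨j, hj, hmin⟩ := hfin.exists_minimal ⟨σ.symm v, le_rfl, by simp⟩
  refine ⟨σ j, by have := hj.2; omega, ?_⟩
  rw [isRecordValue_apply_iff]
  intro l hl
  by_contra! hlt
  have := hmin (y := l) ⟨by have := hj.1; omega, by have := hj.2; omega⟩ hl.le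
  omega

/-- Above any value some value stands to the right of it. -/
theorem IsAdmissible.exists_greater_right {σ : Equiv.Perm ℤ} (h : IsAdmissible σ) (v : ℤ) :
    ∃ u > v, σ.symm v < σ.symm u := by
  obtain ⟨u, hu, hu'⟩ := (Set.Ioi_infinite v).exists_notMem_finite (h.finite_greater_left v)
  refine ⟨u, hu, ?_⟩
  simp only [Set.mem_ofPred_eq, not_and, not_lt] at hu'
  exact lt_of_le_of_ne (hu' hu) fun e => (ne_of_gt hu) (σ.symm.injective e).symm

theorem IsAdmissible.exists_isRecordIndex_ge {σ : Equiv.Perm ℤ} (h : IsAdmissible σ) (i : ℤ) :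
    ∃ j ≥ i, IsRecordIndex σ j := by
  obtain ⟨v, hv⟩ := ((h.finite_left i (σ i - 1)).image σ).bddAbove
  obtain ⟨u, hu, hr⟩ := h.exists_le_isRecordValue (v + 1)
  refine ⟨σ.symm u, ?_, by rw [← isRecordValue_apply_iff]; simpa using hr⟩
  have h₁ : σ i ≤ v := hv ⟨i, ⟨le_rfl, by omega⟩, rfl⟩
  by_contra! hlt
  have := hv ⟨σ.symm u, ⟨hlt.le, by simp; omega⟩, rfl⟩
  simp at this
  omega

/-- A set of integers that is unbounded on both sides is enumerated increasingly by `ℤ`. -/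
theorem exists_strictMono_range_eq {S : Set ℤ} (h₁ : ∀ i, ∃ j ≤ i, j ∈ S)
    (h₂ : ∀ i, ∃ j ≥ i, j ∈ S) : ∃ r : ℤ → ℤ, StrictMono r ∧ Set.range r = S := by
  classical
  have : NoMaxOrder S := ⟨fun a => by
    obtain ⟨j, hj, hjS⟩ := h₂ (a + 1)
    exact ⟨⟨j, hjS⟩, Subtype.mk_lt_mk.2 (by omega)⟩⟩
  have : NoMinOrder S := ⟨fun a => by
    obtain ⟨j, hj, hjS⟩ := h₁ (a - 1)
    exact ⟨⟨j, hjS⟩, Subtype.mk_lt_mk.2 (by omega)⟩⟩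
  have : Nonempty S := by
    obtain ⟨j, -, hj⟩ := h₁ 0
    exact ⟨⟨j, hj⟩⟩
  let : LocallyFiniteOrder S := Subtype.instLocallyFiniteOrder (· ∈ S)
  let : SuccOrder S := LinearLocallyFiniteOrder.succOrder S
  let : PredOrder S := LinearLocallyFiniteOrder.predOrder S
  let e : S ≃o ℤ := orderIsoIntOfLinearSuccPredArch
  refine ⟨fun k => (e.symm k : ℤ), fun a b hab => e.symm.strictMono hab, ?_⟩
  ext i
  constructor
  · rintro ⟨k, rfl⟩
    exact (e.symm k).2
  · intro hi
    exact ⟨e ⟨i, hi⟩, by simp⟩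

theorem IsAdmissible.exists_isStdRecordRep {σ : Equiv.Perm ℤ} (h : IsAdmissible σ) :
    ∃ r, IsStdRecordRep σ r := by
  obtain ⟨r, hr, hrange⟩ := exists_strictMono_range_eq (S := {i | IsRecordIndex σ i})
    h.exists_isRecordIndex_le h.exists_isRecordIndex_ge
  have hrec : ∀ k, IsRecordIndex σ (r k) := fun k => by
    have : r k ∈ Set.range r := ⟨k, rfl⟩
    rwa [hrange] at this
  have hmono : StrictMono fun k => σ (r k) := fun _ l hkl => hrec l _ (hr hkl)
  have hpos : ∃ k, 0 < σ (r k) := by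
    obtain ⟨u, hu, hR⟩ := h.exists_le_isRecordValue 1
    have : σ.symm u ∈ Set.range r := by
      rw [hrange, Set.mem_ofPred_eq, ← isRecordValue_apply_iff]
      simpa using hR
    obtain ⟨k, hk⟩ := this
    exact ⟨k, by rw [hk]; simp; omega⟩
  have hneg : ∃ k, σ (r k) ≤ 0 := by
    obtain ⟨b, hb⟩ := h.2.bddBelow
    -- Left of `min b 0` no index crosses the cut upwards, so a record index there has a
    -- non-positive image.
    obtain ⟨j, hj, hR⟩ := h.exists_isRecordIndex_le (min b 0 - 1)
    have : j ∈ Set.range r := by rwa [hrange]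
    obtain ⟨k, rfl⟩ := this
    refine ⟨k, ?_⟩
    by_contra! hlt
    have := hb ⟨by omega, hlt⟩
    omega
  obtain ⟨k₁, hk₁⟩ := hpos
  have hb : ∀ k, σ (r k) ≤ 0 → k ≤ k₁ := fun k hk => by
    by_contra! hlt
    have := hmono hlt
    simp only at this
    omega
  -- The last record with a non-positive value is moved to index `0`.
  obtain ⟨m, hm, hmax⟩ := Int.exists_greatest_of_bdd ⟨k₁, hb⟩ hneg
  refine ⟨fun k => r (k + m), fun a b hab => hr (by omega), ?_, by simpa using hm, ?_⟩
  · rw [← hrange]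
    ext i
    constructor
    · rintro ⟨k, rfl⟩
      exact ⟨_, rfl⟩
    · rintro ⟨k, rfl⟩
      exact ⟨k - m, by simp⟩
  · by_contra! hle
    have := hmax _ hle
    omega

/-- The increasing enumeration of the record values of `σ`. -/
noncomputable def recordValue (σ : Equiv.Perm ℤ) (k : ℤ) : ℤ := σ (stdRecord σ k)

theorem IsAdmissible.isStdRecordRep {σ : Equiv.Perm ℤ} (h : IsAdmissible σ) :
    IsStdRecordRep σ (stdRecord σ) := by
  rw [stdRecord, dif_pos h.exists_isStdRecordRep]
  exact h.exists_isStdRecordRep.choose_spec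

theorem IsAdmissible.range_recordValue {σ : Equiv.Perm ℤ} (h : IsAdmissible σ) :
    Set.range (recordValue σ) = {u | IsRecordValue σ u} := by
  have hr := h.isStdRecordRep.2.1
  ext u
  constructor
  · rintro ⟨k, rfl⟩
    have : stdRecord σ k ∈ Set.range (stdRecord σ) := ⟨k, rfl⟩
    rw [hr] at this
    exact isRecordValue_apply_iff.2 this
  · intro hu
    have : σ.symm u ∈ Set.range (stdRecord σ) := by
      rw [hr, Set.mem_ofPred_eq, ← isRecordValue_apply_iff]
      simpa using hu
    obtain ⟨k, hk⟩ := this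
    exact ⟨k, by simp [recordValue, hk]⟩

theorem IsAdmissible.isRecordValue_recordValue {σ : Equiv.Perm ℤ} (h : IsAdmissible σ) (k : ℤ) :
    IsRecordValue σ (recordValue σ k) := by
  have : recordValue σ k ∈ Set.range (recordValue σ) := ⟨k, rfl⟩
  rwa [h.range_recordValue] at this

theorem IsAdmissible.strictMono_recordValue {σ : Equiv.Perm ℤ} (h : IsAdmissible σ) :
    StrictMono (recordValue σ) := fun _ l hkl =>
  isRecordValue_apply_iff.1 (h.isRecordValue_recordValue l) _ (h.isStdRecordRep.1 hkl)

theorem IsAdmissible.recordValue_zero_le {σ : Equiv.Perm ℤ} (h : IsAdmissible σ) :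
    recordValue σ 0 ≤ 0 := h.isStdRecordRep.2.2.1

theorem IsAdmissible.recordValue_one_pos {σ : Equiv.Perm ℤ} (h : IsAdmissible σ) :
    0 < recordValue σ 1 := h.isStdRecordRep.2.2.2

/-- The record values between `x` and `y` (inclusively) are exactly the values of `a`. -/
def RecordsAgree (σ : Equiv.Perm ℤ) (a : ℤ → ℤ) (x y : ℤ) : Prop :=
  ∀ u, x ≤ u → u ≤ y → (IsRecordValue σ u ↔ u ∈ Set.range a)

/-- An element of the range of a strictly monotone enumeration between two consecutive terms. -/
theorem StrictMono.le_of_lt_succ {a : ℤ → ℤ} (ha : StrictMono a) {k l : ℤ}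
    (h : a l < a (k + 1)) : a l ≤ a k :=
  ha.monotone (Int.lt_add_one_iff.1 (ha.lt_iff_lt.1 h))

/-- Both sequences enumerate the same records in the window, and the cut between `0` and `1` pins
the index `0`; induction in both directions does the rest. An event about the numbering of the
records becomes one about which values are records. -/
theorem recordValue_eq_iff_recordsAgree {σ : Equiv.Perm ℤ} (h : IsAdmissible σ) {a : ℤ → ℤ}
    (ha : StrictMono a) (ha₀ : a 0 ≤ 0) (ha₁ : 0 < a 1) {m n : ℤ} (hm : m ≤ 0) (hn : 1 ≤ n) :
    (∀ k, m ≤ k → k ≤ n → recordValue σ k = a k) ↔ RecordsAgree σ a (a m) (a n) := by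
  have hV := h.strictMono_recordValue
  have hrec : ∀ u, IsRecordValue σ u ↔ u ∈ Set.range (recordValue σ) := fun u => by
    rw [h.range_recordValue]; rfl
  constructor
  · intro H u hu₁ hu₂
    rw [hrec]
    constructor
    · rintro ⟨k, rfl⟩
      rw [← H m le_rfl (by omega), hV.le_iff_le] at hu₁
      rw [← H n (by omega) le_rfl, hV.le_iff_le] at hu₂
      exact ⟨k, (H k hu₁ hu₂).symm⟩
    · rintro ⟨k, rfl⟩
      rw [ha.le_iff_le] at hu₁ hu₂
      exact ⟨k, H k hu₁ hu₂⟩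
  · intro H
    have hmem : ∀ k, m ≤ k → k ≤ n → ∃ l, recordValue σ l = a k := fun k h₁ h₂ =>
      (hrec _).1 ((H _ (ha.monotone h₁) (ha.monotone h₂)).2 ⟨k, rfl⟩)
    have hmem' : ∀ k, a m ≤ recordValue σ k → recordValue σ k ≤ a n →
        ∃ l, a l = recordValue σ k := fun k h₁ h₂ =>
      (H _ h₁ h₂).1 (h.isRecordValue_recordValue k)
    have zero : recordValue σ 0 = a 0 := by
      obtain ⟨l, hl⟩ := hmem 0 hm (by omega)
      have hl₀ : l ≤ 0 := by
        by_contra! hlt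
        have := hV.monotone (show (1 : ℤ) ≤ l by omega)
        have := h.recordValue_one_pos
        omega
      have h₁ : a 0 ≤ recordValue σ 0 := hl ▸ hV.monotone hl₀
      have h₂ := h.recordValue_zero_le
      obtain ⟨l', hl'⟩ := hmem' 0 ((ha.monotone hm).trans h₁) (by
        have := ha.monotone hn; omega)
      have : a l' ≤ a 0 := StrictMono.le_of_lt_succ ha (by rw [hl']; simpa using by omega)
      omega
    have up : ∀ k, 0 ≤ k → k ≤ n → recordValue σ k = a k := by
      intro k hk
      induction k, hk using Int.leInduction with
      | base => exact fun _ => zero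
      | succ k hk ih =>
        intro hkn
        have ih := ih (by omega)
        obtain ⟨l, hl⟩ := hmem (k + 1) (by omega) hkn
        have h₁ : recordValue σ (k + 1) ≤ a (k + 1) := by
          rw [← hl]
          apply hV.monotone
          have : recordValue σ k < recordValue σ l := by
            rw [hl, ih]; exact ha (by omega)
          have := hV.lt_iff_lt.1 this
          omega
        have h₂ : a k < recordValue σ (k + 1) := by
          rw [← ih]; exact hV (by omega)
        obtain ⟨l', hl'⟩ := hmem' (k + 1) ((ha.monotone (by omega)).trans h₂.le)
          (h₁.trans (ha.monotone hkn))
        rw [← hl'] at h₂ h₁ ⊢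
        have h₃ := ha.lt_iff_lt.1 h₂
        exact le_antisymm h₁ (ha.monotone (by omega))
    have down : ∀ k, k ≤ 0 → m ≤ k → recordValue σ k = a k := by
      intro k hk
      induction k, hk using Int.leInductionDown with
      | base => exact fun _ => zero
      | pred k hk ih =>
        intro hkn
        have ih := ih (by omega)
        obtain ⟨l, hl⟩ := hmem (k - 1) hkn (by omega)
        have h₁ : a (k - 1) ≤ recordValue σ (k - 1) := by
          rw [← hl]
          apply hV.monotone
          have : recordValue σ l < recordValue σ k := by
            rw [hl, ih]; exact ha (by omega)
          have := hV.lt_iff_lt.1 this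
          omega
        have h₂ : recordValue σ (k - 1) < a k := by
          rw [← ih]; exact hV (by omega)
        obtain ⟨l', hl'⟩ := hmem' (k - 1) ((ha.monotone hkn).trans h₁)
          (h₂.le.trans (ha.monotone (by omega)))
        rw [← hl'] at h₂ h₁ ⊢
        have h₃ := ha.lt_iff_lt.1 h₂
        exact le_antisymm (ha.monotone (by omega)) h₁
    intro k h₁ h₂
    rcases le_total 0 k with hk | hk
    · exact up k hk h₂
    · exact down k hk h₁

/-! ### Finite Mallows permutations -/

/-- The pair `(x, y)` becomes an inversion, and applying the swap to both coordinates matches the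
other inversions bijectively. -/
theorem inversions_mul_swap {n : ℕ} (τ : Equiv.Perm (Fin n)) {x y : Fin n}
    (hxy : (x : ℕ) + 1 = y) (h : τ x < τ y) :
    inversions (τ * Equiv.swap x y) = inversions τ + 1 := by
  have key : ∀ a b : Fin n, a < b → ¬(a = x ∧ b = y) → Equiv.swap x y a < Equiv.swap x y b := by
    clear h
    intro a b hab hne
    simp only [Equiv.swap_apply_def]
    split_ifs <;> simp only [Fin.lt_def, Fin.ext_iff] at * <;> omega
  have hmem : (x, y) ∈ Finset.univ.filter fun p : Fin n × Fin n =>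
      p.1 < p.2 ∧ (τ * Equiv.swap x y) p.2 < (τ * Equiv.swap x y) p.1 := by
    refine Finset.mem_filter.2 ⟨Finset.mem_univ _, Fin.lt_def.2 (by simp only; omega), ?_⟩
    simpa using h
  rw [inversions, ← Finset.card_erase_add_one hmem, inversions, Nat.add_right_cancel_iff]
  refine Finset.card_bij' (fun p _ => (Equiv.swap x y p.1, Equiv.swap x y p.2))
    (fun p _ => (Equiv.swap x y p.1, Equiv.swap x y p.2)) ?_ ?_ ?_ ?_
  · rintro ⟨a, b⟩ hp
    obtain ⟨hne, hp⟩ := Finset.mem_erase.1 hp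
    obtain ⟨-, hab, hp⟩ := Finset.mem_filter.1 hp
    exact Finset.mem_filter.2 ⟨Finset.mem_univ _, key _ _ hab (by simpa using hne), hp⟩
  · rintro ⟨a, b⟩ hp
    obtain ⟨-, hab, hp⟩ := Finset.mem_filter.1 hp
    refine Finset.mem_erase.2 ⟨fun h' => ?_, Finset.mem_filter.2 ⟨Finset.mem_univ _,
      key _ _ hab ?_, by simpa using hp⟩⟩
    · simp only [Prod.mk.injEq] at h'
      have ha : a = y := by rw [← Equiv.swap_apply_self x y a, h'.1, Equiv.swap_apply_left]
      have hb : b = x := by rw [← Equiv.swap_apply_self x y b, h'.2, Equiv.swap_apply_right]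
      simp only [ha, hb, Fin.lt_def] at hab
      omega
    · rintro ⟨rfl, rfl⟩
      exact lt_asymm h hp
  · rintro ⟨a, b⟩ -
    simp
  · rintro ⟨a, b⟩ -
    simp

theorem inversions_one (n : ℕ) : inversions (1 : Equiv.Perm (Fin n)) = 0 := by
  rw [inversions, Finset.card_eq_zero, Finset.filter_eq_empty_iff]
  rintro ⟨a, b⟩ -
  simp only [Equiv.Perm.one_apply, not_and, not_lt]
  exact le_of_lt

theorem exists_descent {n : ℕ} {τ : Equiv.Perm (Fin n)} (h : τ ≠ 1) :
    ∃ x y : Fin n, (x : ℕ) + 1 = y ∧ τ y < τ x := by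
  by_contra! H
  apply h
  have hmono : StrictMono τ := by
    cases n with
    | zero => exact fun a => a.elim0
    | succ n =>
      rw [Fin.strictMono_iff_lt_succ]
      intro i
      refine lt_of_le_of_ne (H _ _ (by simp)) fun e => ?_
      have := congrArg Fin.val (τ.injective e)
      simp at this
  have : (hmono.orderIsoOfSurjective _ τ.surjective : Fin n ≃o Fin n) = OrderIso.refl _ :=
    Subsingleton.elim _ _
  ext i
  exact congrArg Fin.val (DFunLike.congr_fun this i)

theorem sum_pow_inversions_pos {q : ℝ} (hq : 0 ≤ q) (n : ℕ) :
    0 < ∑ τ : Equiv.Perm (Fin n), q ^ inversions τ := by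
  refine Finset.sum_pos' (fun τ _ => pow_nonneg hq _) ⟨1, Finset.mem_univ _, ?_⟩
  simp [inversions_one]

/-- A weight that is multiplied by `q` whenever an ascent is turned into a descent is
proportional to the Mallows distribution. -/
theorem eq_sum_mul_mallowsProb {q : ℝ} (hq : 0 ≤ q) {n : ℕ} {g : Equiv.Perm (Fin n) → ℝ}
    (hg : ∀ (τ : Equiv.Perm (Fin n)) (x y : Fin n), (x : ℕ) + 1 = y → τ x < τ y →
      g (τ * Equiv.swap x y) = q * g τ) (τ : Equiv.Perm (Fin n)) :
    g τ = (∑ ρ, g ρ) * mallowsProb q τ := by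
  -- Every non-identity permutation has a descent; undoing it removes one inversion, and the
  -- induction ends at the identity.
  have key : ∀ ρ, g ρ = g 1 * q ^ inversions ρ := by
    intro ρ
    induction hm : inversions ρ using Nat.strong_induction_on generalizing ρ with
    | _ m ih =>
      by_cases hρ : ρ = 1
      · subst hρ
        simp [← hm, inversions_one]
      · obtain ⟨x, y, hxy, hd⟩ := exists_descent hρ
        have hasc : (ρ * Equiv.swap x y) x < (ρ * Equiv.swap x y) y := by simpa using hd
        have hback : ρ * Equiv.swap x y * Equiv.swap x y = ρ := by simp [mul_assoc]
        have hinv := inversions_mul_swap _ hxy hasc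
        have hgg := hg _ x y hxy hasc
        rw [hback] at hinv hgg
        rw [hgg, ih _ (by omega) _ rfl, ← hm, hinv, pow_succ]
        ring
  have hZ := sum_pow_inversions_pos hq n
  rw [Finset.sum_congr rfl fun ρ _ => key ρ, key τ, ← Finset.mul_sum, mallowsProb]
  field_simp

theorem mallowsProb_nonneg {q : ℝ} (hq : 0 ≤ q) {n : ℕ} (τ : Equiv.Perm (Fin n)) :
    0 ≤ mallowsProb q τ :=
  div_nonneg (pow_nonneg hq _) (sum_pow_inversions_pos hq n).le

theorem sum_mallowsProb {q : ℝ} (hq : 0 ≤ q) (n : ℕ) :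
    ∑ τ : Equiv.Perm (Fin n), mallowsProb q τ = 1 := by
  simp_rw [mallowsProb]
  rw [← Finset.sum_div, div_self (sum_pow_inversions_pos hq n).ne']

/-- The sequence `a + τ(1), …, a + τ(n)`. -/
def shiftWord (a : ℤ) {n : ℕ} (τ : Equiv.Perm (Fin n)) : List ℤ :=
  (permWord τ).map fun u => a + u

theorem shiftWord_eq_ofFn (a : ℤ) {n : ℕ} (τ : Equiv.Perm (Fin n)) :
    shiftWord a τ = List.ofFn fun i => a + (((τ i : ℕ) : ℤ) + 1) := by
  rw [shiftWord, permWord, List.map_ofFn]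
  rfl

theorem bst_shiftWord (a : ℤ) {n : ℕ} (τ : Equiv.Perm (Fin n)) :
    bst (shiftWord a τ) = bst (permWord τ) :=
  bst_map (fun _ _ h => by simpa using h) _

theorem card_bst_permWord {n : ℕ} (τ : Equiv.Perm (Fin n)) : (bst (permWord τ)).card = n := by
  rw [card_bst, permWord, List.length_ofFn]
  rw [permWord, List.nodup_ofFn]
  intro i j h
  apply τ.injective
  ext
  simpa using h

theorem wordBetween_eq_shiftWord_iff {σ : Equiv.Perm ℤ} {a : ℤ} {n : ℕ}
    {τ : Equiv.Perm (Fin n)} :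
    wordBetween σ a (a + n + 1) = shiftWord a τ ↔
      ∀ i j : Fin n, i < j →
        σ.symm (a + (((τ i : ℕ) : ℤ) + 1)) < σ.symm (a + (((τ j : ℕ) : ℤ) + 1)) := by
  rw [wordBetween_eq_iff, shiftWord_eq_ofFn, List.pairwise_ofFn, and_iff_right]
  intro u
  rw [List.mem_ofFn']
  constructor
  · rintro ⟨i, rfl⟩
    simp only
    constructor <;> omega
  · rintro ⟨h₁, h₂⟩
    refine ⟨τ.symm ⟨(u - a - 1).toNat, by omega⟩, ?_⟩
    simp only [Equiv.apply_symm_apply]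
    omega

theorem shiftWord_injective (a : ℤ) (n : ℕ) :
    Function.Injective fun τ : Equiv.Perm (Fin n) => shiftWord a τ := by
  intro τ ρ h
  simp only [shiftWord_eq_ofFn] at h
  have := List.ofFn_injective h
  ext i
  have : a + (((τ i : ℕ) : ℤ) + 1) = a + (((ρ i : ℕ) : ℤ) + 1) := congrFun this i
  omega

theorem exists_wordBetween_eq_shiftWord (σ : Equiv.Perm ℤ) (a : ℤ) (n : ℕ) :
    ∃ τ : Equiv.Perm (Fin n), wordBetween σ a (a + n + 1) = shiftWord a τ := by
  set w := wordBetween σ a (a + n + 1) with hw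
  have hlen : w.length = n := by
    rw [hw, length_wordBetween]
    omega
  have hmem : ∀ u, u ∈ w ↔ a < u ∧ u < a + n + 1 := (wordBetween_eq_iff.1 rfl).1
  have hnd : w.Nodup := nodup_wordBetween σ _ _
  have hget : ∀ i : Fin n, a < w[i]'(by omega) ∧ w[i]'(by omega) < a + n + 1 := fun i =>
    (hmem _).1 (List.getElem_mem _)
  let f : Fin n → Fin n := fun i =>
    ⟨(w[i]'(by omega) - a - 1).toNat, by have := hget i; omega⟩
  have hf : Function.Injective f := by
    intro i j hij
    have h₁ := hget i
    have h₂ := hget j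
    simp only [f, Fin.mk.injEq] at hij
    have h₃ : w[i]'(by omega) = w[j]'(by omega) := by omega
    ext
    exact (List.Nodup.getElem_inj_iff hnd).1 h₃
  refine ⟨Equiv.ofBijective f (Finite.injective_iff_bijective.1 hf), ?_⟩
  rw [shiftWord_eq_ofFn]
  apply List.ext_getElem
  · simp [hlen]
  · intro i h₁ h₂
    have := hget ⟨i, by omega⟩
    simp only [List.getElem_ofFn, Equiv.ofBijective_apply, f]
    simp only [Fin.getElem_fin] at this ⊢
    omega

/-! ### The measurable space of permutations -/

/-- The `σ`-algebra generated by the evaluations. -/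
instance measurableSpacePerm : MeasurableSpace (Equiv.Perm ℤ) :=
  MeasurableSpace.comap (fun σ : Equiv.Perm ℤ => (σ : ℤ → ℤ)) inferInstance

theorem measurable_perm_iff {α : Type*} [MeasurableSpace α] {f : α → Equiv.Perm ℤ} :
    Measurable f ↔ ∀ i, Measurable fun a => f a i := by
  rw [measurable_comap_iff, measurable_pi_iff]
  rfl

@[fun_prop]
theorem measurable_perm_apply (i : ℤ) : Measurable fun σ : Equiv.Perm ℤ => σ i :=
  measurable_perm_iff.1 measurable_id i

@[fun_prop]
theorem measurable_perm_symm_apply (u : ℤ) : Measurable fun σ : Equiv.Perm ℤ => σ.symm u := by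
  refine measurable_to_countable' fun i => ?_
  have : (fun σ : Equiv.Perm ℤ => σ.symm u) ⁻¹' {i} = (fun σ : Equiv.Perm ℤ => σ i) ⁻¹' {u} := by
    ext σ
    simp only [Set.mem_preimage, Set.mem_singleton_iff]
    rw [Equiv.symm_apply_eq, eq_comm]
  rw [this]
  exact measurable_perm_apply i (measurableSet_singleton u)

theorem measurable_perm_mul_right (g : Equiv.Perm ℤ) :
    Measurable fun σ : Equiv.Perm ℤ => σ * g :=
  measurable_perm_iff.2 fun i => measurable_perm_apply (g i)

theorem measurable_perm_mul_left (g : Equiv.Perm ℤ) :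
    Measurable fun σ : Equiv.Perm ℤ => g * σ :=
  measurable_perm_iff.2 fun i => (measurable_of_countable g).comp (measurable_perm_apply i)

theorem measurableSet_apply_lt (i j : ℤ) : MeasurableSet {σ : Equiv.Perm ℤ | σ i < σ j} :=
  measurableSet_lt (by fun_prop) (by fun_prop)

theorem measurableSet_symm_lt (u v : ℤ) :
    MeasurableSet {σ : Equiv.Perm ℤ | σ.symm u < σ.symm v} :=
  measurableSet_lt (by fun_prop) (by fun_prop)

theorem measurableSet_finite {α : Type*} [MeasurableSpace α] {p : α → ℤ → Prop}
    (hp : ∀ i, MeasurableSet {a | p a i}) : MeasurableSet {a | {i | p a i}.Finite} := by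
  have : {a | {i | p a i}.Finite} = ⋃ S : Finset ℤ, ⋂ i : ℤ, {a | p a i → i ∈ S} := by
    ext a
    simp only [Set.mem_ofPred_eq, Set.mem_iUnion, Set.mem_iInter]
    constructor
    · intro h
      exact ⟨h.toFinset, fun i hi => by simpa using hi⟩
    · rintro ⟨S, hS⟩
      exact S.finite_toSet.subset hS
  rw [this]
  exact .iUnion fun S => .iInter fun i => (hp i).imp (.const _)

theorem measurableSet_isAdmissible : MeasurableSet {σ : Equiv.Perm ℤ | IsAdmissible σ} := by
  refine (measurableSet_finite fun i => ?_).inter (measurableSet_finite fun i => ?_)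
  · exact (MeasurableSet.const _).inter
      (measurableSet_le (measurable_perm_apply i) measurable_const)
  · exact (MeasurableSet.const _).inter
      (measurableSet_lt measurable_const (measurable_perm_apply i))

/-! ### Laws of Mallows permutations -/

/-- `μ` is the law of an admissible `q`-invariant random permutation of `ℤ`. -/
structure IsMallowsLaw (q : ℝ) (μ : Measure (Equiv.Perm ℤ)) : Prop where
  admissible : ∀ᵐ σ ∂μ, IsAdmissible σ
  invariant : ∀ (i : ℤ) (A : Set (Equiv.Perm ℤ)), MeasurableSet A → (∀ σ ∈ A, σ i < σ (i + 1)) →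
    μ {σ | σ * Equiv.swap i (i + 1) ∈ A} = ENNReal.ofReal q * μ A

theorem IsMallowsPermutation.measurable_perm {Ω : Type*} [MeasurableSpace Ω] {q : ℝ}
    {P : Measure Ω} {X : Ω → Equiv.Perm ℤ} (hX : IsMallowsPermutation q P X) : Measurable X :=
  measurable_perm_iff.2 hX.measurable

theorem IsMallowsPermutation.isMallowsLaw_map {Ω : Type*} [MeasurableSpace Ω] {q : ℝ}
    {P : Measure Ω} {X : Ω → Equiv.Perm ℤ} (hX : IsMallowsPermutation q P X) :
    IsMallowsLaw q (P.map X) := by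
  have hm := hX.measurable_perm
  refine ⟨?_, ?_⟩
  · rw [ae_map_iff hm.aemeasurable measurableSet_isAdmissible]
    filter_upwards [hX.balanced] with ω hω using hω.1
  · intro i A hA hAi
    have hA' := hA
    obtain ⟨B, hB, rfl⟩ := hA
    refine (Measure.map_apply hm (measurable_perm_mul_right _ hA')).trans ?_
    rw [Measure.map_apply hm hA']
    -- The intersection is needed because `B` may contain functions that are not permutations and do
    -- not ascend at `i`.
    have := hX.q_invariant i (B ∩ {f | f i < f (i + 1)})
      (hB.inter (measurableSet_lt (by fun_prop) (by fun_prop))) (fun f hf => hf.2)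
    have e : {ω | (fun j => X ω j) ∈ B ∩ {f | f i < f (i + 1)}} =
        X ⁻¹' ((fun σ : Equiv.Perm ℤ => (σ : ℤ → ℤ)) ⁻¹' B) :=
      Set.ext fun ω => ⟨fun h => h.1, fun h => ⟨h, hAi _ h⟩⟩
    rw [← e, ← this]
    congr 1
    exact Set.ext fun ω => ⟨fun h => ⟨h, hAi _ h⟩, fun h => h.1⟩

variable {q : ℝ} {μ : Measure (Equiv.Perm ℤ)}

/-- The invariance read backwards, the swap being an involution. -/
theorem IsMallowsLaw.measure_of_descent (hμ : IsMallowsLaw q μ) (i : ℤ)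
    {A : Set (Equiv.Perm ℤ)} (hA : MeasurableSet A) (h : ∀ σ ∈ A, σ (i + 1) < σ i) :
    μ A = ENNReal.ofReal q * μ {σ | σ * Equiv.swap i (i + 1) ∈ A} := by
  have := hμ.invariant i {σ | σ * Equiv.swap i (i + 1) ∈ A} (measurable_perm_mul_right _ hA)
    (fun σ hσ => by simpa using h _ hσ)
  simpa [mul_assoc] using this

/-- Treats `q = 0` separately, because the extension to distant positions cancels a factor `q`. -/
theorem IsMallowsLaw.ae_strictMono (hμ : IsMallowsLaw q μ) (hq : ENNReal.ofReal q = 0) :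
    ∀ᵐ σ : Equiv.Perm ℤ ∂μ, StrictMono σ := by
  have : ∀ i : ℤ, ∀ᵐ σ : Equiv.Perm ℤ ∂μ, σ i < σ (i + 1) := fun i => by
    have h := hμ.measure_of_descent i (measurableSet_apply_lt (i + 1) i) (fun σ hσ => hσ)
    rw [hq, zero_mul] at h
    rw [ae_iff]
    refine measure_mono_null (fun σ hσ => ?_) h
    simp only [Set.mem_ofPred_eq, not_lt] at hσ ⊢
    refine lt_of_le_of_ne hσ fun e => ?_
    have := σ.injective e
    omega
  filter_upwards [ae_all_iff.2 this] with σ hσ using strictMono_int_of_lt_succ hσ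

/-- Exchanging two increasing images multiplies the probability by `q`, provided that no image in
between lies strictly between them. -/
theorem IsMallowsLaw.measure_swap_add (hμ : IsMallowsLaw q μ) (d : ℕ) (p : ℤ)
    {A : Set (Equiv.Perm ℤ)} (hA : MeasurableSet A)
    (h : ∀ σ ∈ A, σ p < σ (p + 1 + d) ∧
      ∀ j, p < j → j < p + 1 + d → ¬(σ p < σ j ∧ σ j < σ (p + 1 + d))) :
    μ {σ | σ * Equiv.swap p (p + 1 + d) ∈ A} = ENNReal.ofReal q * μ A := by
  by_cases hq : ENNReal.ofReal q = 0
  · rw [hq, zero_mul]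
    have := hμ.ae_strictMono hq
    rw [ae_iff] at this
    refine measure_mono_null (fun σ hσ => ?_) this
    rw [Set.mem_ofPred_eq]
    intro hmono
    have h₁ := (h _ hσ).1
    simp only [Equiv.Perm.mul_apply, Equiv.swap_apply_left, Equiv.swap_apply_right] at h₁
    have := hmono.lt_iff_lt.1 h₁
    omega
  have hmeas : ∀ (g : Equiv.Perm ℤ) {B : Set (Equiv.Perm ℤ)}, MeasurableSet B →
      MeasurableSet {σ | σ * g ∈ B} := fun g B hB => measurable_perm_mul_right g hB
  induction d generalizing p A with
  | zero => simpa using hμ.invariant p A hA (fun σ hσ => by simpa using (h σ hσ).1)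
  | succ d ih =>
    set s := Equiv.swap p (p + 1) with hs
    set t := Equiv.swap (p + 1) (p + 1 + 1 + d) with ht
    have e : p + 1 + ((d + 1 : ℕ) : ℤ) = p + 1 + 1 + d := by push_cast; ring
    rw [e] at h ⊢
    -- Induction on the distance by conjugation with the adjacent swap `s`. By hypothesis the image
    -- at `p + 1` lies below both exchanged images (`low`) or above both (`high`), so the two
    -- factors `s` change the inversion number in opposite directions.
    have hst : Equiv.swap p (p + 1 + 1 + d) = s * t * s := by
      rw [hs, ht, Equiv.swap_comm p (p + 1), Equiv.swap_comm (p + 1) (p + 1 + 1 + d),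
        Equiv.swap_mul_swap_mul_swap] <;> omega
    have hs₀ : s p = p + 1 := Equiv.swap_apply_left _ _
    have hs₁ : s (p + 1) = p := Equiv.swap_apply_right _ _
    have hs₂ : ∀ j, p + 1 < j → s j = j := fun j hj =>
      Equiv.swap_apply_of_ne_of_ne (by omega) (by omega)
    have ht₀ : t p = p := Equiv.swap_apply_of_ne_of_ne (by omega) (by omega)
    have ht₁ : t (p + 1) = p + 1 + 1 + d := Equiv.swap_apply_left _ _
    have ht₂ : t (p + 1 + 1 + d) = p + 1 := Equiv.swap_apply_right _ _
    have inner : ∀ A' ⊆ A, MeasurableSet A' →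
        μ {σ | σ * t * s ∈ A'} = ENNReal.ofReal q * μ {σ | σ * s ∈ A'} := by
      intro A' hA' hm
      refine ih (p + 1) (hmeas s hm) fun σ hσ => ?_
      obtain ⟨h₁, h₂⟩ := h _ (hA' hσ)
      simp only [Equiv.Perm.mul_apply, hs₀, hs₂ (p + 1 + 1 + d) (by omega)] at h₁ h₂
      refine ⟨h₁, fun j hj hj' => ?_⟩
      have := h₂ j (by omega) hj'
      rwa [hs₂ j hj] at this
    have low : ∀ A' ⊆ A, MeasurableSet A' → (∀ σ ∈ A', σ (p + 1) < σ p) →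
        μ {σ | σ * s * t * s ∈ A'} = ENNReal.ofReal q * μ A' := by
      intro A' hA' hm hlow
      have h₁ := hμ.measure_of_descent p hm hlow
      have h₂ : μ {σ | σ * s * t * s ∈ A'} = ENNReal.ofReal q * μ {σ | σ * t * s ∈ A'} :=
        hμ.invariant p {σ | σ * t * s ∈ A'} (hmeas t (hmeas s hm)) (by
        intro σ hσ
        have h₃ := (h _ (hA' hσ)).1
        have h₄ := hlow _ hσ
        simp only [Equiv.Perm.mul_apply, hs₀, hs₁, hs₂ (p + 1 + 1 + d) (by omega), ht₀, ht₁,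
          ht₂] at h₃ h₄
        omega)
      rw [h₂, inner A' hA' hm, h₁]
    have high : ∀ A' ⊆ A, MeasurableSet A' → (∀ σ ∈ A', σ (p + 1 + 1 + d) < σ (p + 1)) →
        μ {σ | σ * s * t * s ∈ A'} = ENNReal.ofReal q * μ A' := by
      intro A' hA' hm hhigh
      have h₁ := hμ.invariant p A' hm (fun σ hσ => (h σ (hA' hσ)).1.trans (hhigh σ hσ))
      have h₂ : μ {σ | σ * t * s ∈ A'} = ENNReal.ofReal q * μ {σ | σ * s * t * s ∈ A'} :=
        hμ.measure_of_descent p (A := {σ | σ * t * s ∈ A'}) (hmeas t (hmeas s hm)) (by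
        intro σ hσ
        have h₄ := hhigh _ hσ
        simp only [Equiv.Perm.mul_apply, hs₁, hs₂ (p + 1 + 1 + d) (by omega), ht₀,
          ht₂] at h₄
        omega)
      rw [inner A' hA' hm] at h₂
      -- The factor `q` is cancelled here.
      rw [← (ENNReal.mul_right_inj hq ENNReal.ofReal_ne_top).1 h₂, h₁]
    have hU := measurableSet_apply_lt (p + 1) p
    rw [hst, ← measure_inter_add_sdiff A hU, mul_add,
      ← low _ Set.inter_subset_left (hA.inter hU) (fun σ hσ => hσ.2),
      ← high _ Set.sdiff_subset (hA.diff hU) (fun σ hσ => ?_),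
      ← measure_inter_add_sdiff _ (hmeas (s * t * s) hU)]
    · rfl
    · have h₁ := h σ hσ.1
      have h₂ := h₁.2 (p + 1) (by omega) (by omega)
      have h₃ : ¬ σ (p + 1) < σ p := hσ.2
      have h₄ : σ (p + 1) ≠ σ p := fun e => by have := σ.injective e; omega
      have h₅ : σ (p + 1) ≠ σ (p + 1 + 1 + d) := fun e => by have := σ.injective e; omega
      omega

/-- Exchanging two values `x < y` with `x` to the left of `y` multiplies the probability by `q`,
provided that no value in between stands between them. -/
theorem IsMallowsLaw.measure_swap_mul (hμ : IsMallowsLaw q μ) {x y : ℤ} (hxy : x < y)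
    {A : Set (Equiv.Perm ℤ)} (hA : MeasurableSet A)
    (h : ∀ σ ∈ A, σ.symm x < σ.symm y ∧
      ∀ u, x < u → u < y → ¬(σ.symm x < σ.symm u ∧ σ.symm u < σ.symm y)) :
    μ {σ | Equiv.swap x y * σ ∈ A} = ENNReal.ofReal q * μ A := by
  -- Once the position of `x` and the distance to `y` are fixed, exchanging the values is exchanging
  -- two fixed positions; there are countably many cases.
  set D : ℤ × ℕ → Set (Equiv.Perm ℤ) := fun r =>
    A ∩ {σ | σ.symm x = r.1 ∧ σ.symm y = r.1 + 1 + r.2} with hD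
  have hDm : ∀ r, MeasurableSet (D r) := fun r => hA.inter
    ((measurableSet_eq_fun (by fun_prop) (by fun_prop)).inter
      (measurableSet_eq_fun (by fun_prop) (by fun_prop)))
  have hdisj : Pairwise (Function.onFun Disjoint D) := by
    intro r r' hne
    rw [Function.onFun, Set.disjoint_left]
    rintro σ ⟨-, h₁, h₂⟩ ⟨-, h₃, h₄⟩
    apply hne
    ext <;> omega
  have hU : A = ⋃ r, D r := by
    ext σ
    simp only [hD, Set.mem_iUnion, Set.mem_inter_iff, Set.mem_ofPred_eq]
    constructor
    · intro hσ
      have := (h σ hσ).1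
      exact ⟨(σ.symm x, (σ.symm y - σ.symm x - 1).toNat), hσ, rfl, by omega⟩
    · rintro ⟨_, hσ, -⟩
      exact hσ
  have key : ∀ r, μ {σ | Equiv.swap x y * σ ∈ D r} = ENNReal.ofReal q * μ (D r) := by
    intro r
    rw [← hμ.measure_swap_add r.2 r.1 (hDm r)]
    · congr 1
      ext σ
      have haux : ∀ (a b : ℤ), σ a = x → σ b = y →
          Equiv.swap x y * σ = σ * Equiv.swap a b := by
        rintro a b rfl rfl
        rw [Equiv.mul_swap_eq_swap_mul]
      simp only [Set.mem_ofPred_eq]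
      constructor
      · intro hσ
        have h₁ := hσ.2.1
        have h₂ := hσ.2.2
        simp only [Equiv.symm_apply_eq, Equiv.Perm.mul_apply] at h₁ h₂
        rw [eq_comm, Equiv.swap_apply_eq_iff, Equiv.swap_apply_left] at h₁
        rw [eq_comm, Equiv.swap_apply_eq_iff, Equiv.swap_apply_right] at h₂
        rwa [Equiv.swap_comm, ← haux _ _ h₂ h₁]
      · intro hσ
        have h₁ := hσ.2.1
        have h₂ := hσ.2.2
        simp only [Equiv.symm_apply_eq, Equiv.Perm.mul_apply, Equiv.swap_apply_left,
          Equiv.swap_apply_right] at h₁ h₂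
        rwa [haux _ _ h₁.symm h₂.symm, Equiv.swap_comm]
    · rintro σ ⟨hσ, h₁, h₂⟩
      obtain ⟨-, h₃⟩ := h σ hσ
      rw [Equiv.symm_apply_eq] at h₁ h₂
      rw [← h₁, ← h₂]
      refine ⟨hxy, fun j hj hj' hlt => h₃ (σ j) hlt.1 hlt.2 ?_⟩
      rw [h₁, h₂]
      simpa using ⟨hj, hj'⟩
  have hpre : {σ | Equiv.swap x y * σ ∈ A} = ⋃ r, {σ | Equiv.swap x y * σ ∈ D r} := by
    ext σ
    conv_lhs => rw [hU]
    simp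
  rw [hpre, measure_iUnion, hU, measure_iUnion hdisj hDm, ← ENNReal.tsum_mul_left]
  · exact tsum_congr key
  · intro r r' hne
    exact (hdisj hne).preimage (fun σ => Equiv.swap x y * σ)
  · exact fun r => measurable_perm_mul_left _ (hDm r)

/-! ### The record values form a Bernoulli process -/

theorem symm_swap_mul_apply (σ : Equiv.Perm ℤ) (x y u : ℤ) :
    (Equiv.swap x y * σ).symm u = σ.symm (Equiv.swap x y u) := by
  rw [Equiv.symm_apply_eq, Equiv.Perm.mul_apply, Equiv.apply_symm_apply, Equiv.swap_apply_self]

/-- The values larger than `v` that stand to the left of `v`. -/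
def greaterLeft (σ : Equiv.Perm ℤ) (v : ℤ) : Set ℤ := {u | v < u ∧ σ.symm u < σ.symm v}

/-- The permutations with exactly `k` larger values to the left of the value `v`. -/
def greaterLeftEvent (v : ℤ) (k : ℕ) : Set (Equiv.Perm ℤ) := {σ | (greaterLeft σ v).encard = k}

theorem measurableSet_greaterLeftEvent (v : ℤ) (k : ℕ) :
    MeasurableSet (greaterLeftEvent v k) := by
  have : greaterLeftEvent v k = ⋃ S : Finset ℤ, ⋂ u : ℤ,
      {σ | S.card = k ∧ ((v < u ∧ σ.symm u < σ.symm v) ↔ u ∈ S)} := by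
    ext σ
    simp only [greaterLeftEvent, Set.mem_ofPred_eq, Set.mem_iUnion, Set.mem_iInter]
    constructor
    · intro h
      have hfin : (greaterLeft σ v).Finite := Set.finite_of_encard_eq_coe h
      refine ⟨hfin.toFinset, fun u => ⟨?_, by simp [greaterLeft]⟩⟩
      rw [hfin.encard_eq_coe_toFinset_card] at h
      exact_mod_cast h
    · rintro ⟨S, hS⟩
      have : greaterLeft σ v = S := Set.ext fun u => (hS u).2
      rw [this, Set.encard_coe_eq_coe_finsetCard, (hS 0).1]
  rw [this]
  exact .iUnion fun S => .iInter fun u => (MeasurableSet.const _).inter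
    (((MeasurableSet.const _).inter (measurableSet_symm_lt u v)).iff (.const _))

theorem mem_greaterLeftEvent_zero {σ : Equiv.Perm ℤ} {v : ℤ} :
    σ ∈ greaterLeftEvent v 0 ↔ IsRecordValue σ v := by
  simp only [greaterLeftEvent, Set.mem_ofPred_eq, Nat.cast_zero, Set.encard_eq_zero,
    Set.eq_empty_iff_forall_notMem, greaterLeft, IsRecordValue, not_and, not_lt]
  refine forall_congr' fun u => imp_congr_right fun hu => ⟨fun h => lt_of_le_of_ne h fun e => ?_,
    le_of_lt⟩
  have := σ.symm.injective e
  omega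

theorem measurableSet_isRecordValue (v : ℤ) : MeasurableSet {σ | IsRecordValue σ v} := by
  have : {σ | IsRecordValue σ v} = greaterLeftEvent v 0 :=
    Set.ext fun σ => mem_greaterLeftEvent_zero.symm
  rw [this]
  exact measurableSet_greaterLeftEvent v 0

/-- The event `E` depends only on the relative positions of the values larger than `v`. -/
def DependsOnOrderAbove (v : ℤ) (E : Set (Equiv.Perm ℤ)) : Prop :=
  ∀ σ ∈ E, ∀ ρ : Equiv.Perm ℤ,
    (∀ u > v, ∀ w > v, ρ.symm u < ρ.symm w ↔ σ.symm u < σ.symm w) → ρ ∈ E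

/-- The value `y` is the first one larger than `v` to the right of `v`. -/
def IsNextGreater (σ : Equiv.Perm ℤ) (v y : ℤ) : Prop :=
  v < y ∧ σ.symm v < σ.symm y ∧ ∀ u > v, ¬(σ.symm v < σ.symm u ∧ σ.symm u < σ.symm y)

theorem measurableSet_isNextGreater (v y : ℤ) :
    MeasurableSet {σ : Equiv.Perm ℤ | IsNextGreater σ v y} := by
  have : {σ : Equiv.Perm ℤ | IsNextGreater σ v y} = {_σ | v < y} ∩
      ({σ | σ.symm v < σ.symm y} ∩ ⋂ u : ℤ, {σ | u > v →
        ¬(σ.symm v < σ.symm u ∧ σ.symm u < σ.symm y)}) := by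
    ext σ
    simp [IsNextGreater]
  rw [this]
  exact (MeasurableSet.const _).inter ((measurableSet_symm_lt v y).inter
    (.iInter fun u => (MeasurableSet.const _).imp
      ((measurableSet_symm_lt v u).inter (measurableSet_symm_lt u y)).compl))

theorem IsNextGreater.unique {σ : Equiv.Perm ℤ} {v y z : ℤ} (hy : IsNextGreater σ v y)
    (hz : IsNextGreater σ v z) : y = z := by
  have h₁ := hy.2.2 z hz.1
  have h₂ := hz.2.2 y hy.1
  have h₃ := hy.2.1
  have h₄ := hz.2.1
  exact σ.symm.injective (by omega)

theorem IsAdmissible.exists_isNextGreater {σ : Equiv.Perm ℤ} (h : IsAdmissible σ) (v : ℤ) :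
    ∃ y, IsNextGreater σ v y := by
  obtain ⟨y₀, hy₀, hlt⟩ := h.exists_greater_right v
  obtain ⟨p, ⟨y, hy, hvy, rfl⟩, hmin⟩ := Int.exists_least_of_bdd
    (P := fun p => ∃ y > v, σ.symm v < σ.symm y ∧ σ.symm y = p)
    ⟨σ.symm v, fun p ⟨y, _, h₁, h₂⟩ => by omega⟩ ⟨_, y₀, hy₀, hlt, rfl⟩
  refine ⟨y, hy, hvy, fun u hu hlt => ?_⟩
  have := hmin _ ⟨u, hu, hlt.1, rfl⟩
  omega

/-- The value `v` moves right to the place of `y`, and `y` is the only larger value it passes. -/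
theorem IsNextGreater.greaterLeft_swap_mul {σ : Equiv.Perm ℤ} {v y : ℤ}
    (h : IsNextGreater σ v y) :
    greaterLeft (Equiv.swap v y * σ) v = insert y (greaterLeft σ v) := by
  obtain ⟨hvy, hlt, hno⟩ := h
  ext u
  simp only [greaterLeft, symm_swap_mul_apply, Equiv.swap_apply_left, Set.mem_ofPred_eq,
    Set.mem_insert_iff]
  by_cases huy : u = y
  · subst huy
    simp [hvy, hlt]
  · simp only [huy, false_or]
    refine and_congr_right fun hu => ?_
    rw [Equiv.swap_apply_of_ne_of_ne hu.ne' huy]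
    have h₁ := hno u hu
    have h₂ : σ.symm u ≠ σ.symm v := fun e => hu.ne' (σ.symm.injective e)
    have h₃ : σ.symm u ≠ σ.symm y := fun e => huy (σ.symm.injective e)
    omega

/-- Among the values above `v` only `y` moves, and on its way to the place of `v` it passes none of
the others. -/
theorem IsNextGreater.symm_swap_mul_lt_iff {σ : Equiv.Perm ℤ} {v y : ℤ}
    (h : IsNextGreater σ v y) {u w : ℤ} (hu : v < u) (hw : v < w) :
    (Equiv.swap v y * σ).symm u < (Equiv.swap v y * σ).symm w ↔ σ.symm u < σ.symm w := by
  obtain ⟨hvy, hlt, hno⟩ := h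
  have ne : ∀ u w, u ≠ w → σ.symm u ≠ σ.symm w := fun u w h e => h (σ.symm.injective e)
  rw [symm_swap_mul_apply, symm_swap_mul_apply]
  have h₁ := hno u hu
  have h₂ := hno w hw
  by_cases huy : u = y <;> by_cases hwy : w = y
  · simp [huy, hwy]
  · rw [huy, Equiv.swap_apply_right, Equiv.swap_apply_of_ne_of_ne hw.ne' hwy]
    have := ne w y hwy
    have := ne w v hw.ne'
    omega
  · rw [hwy, Equiv.swap_apply_right, Equiv.swap_apply_of_ne_of_ne hu.ne' huy]
    have := ne u y huy
    have := ne u v hu.ne'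
    omega
  · rw [Equiv.swap_apply_of_ne_of_ne hu.ne' huy, Equiv.swap_apply_of_ne_of_ne hw.ne' hwy]

theorem swap_mul_swap_mul_cancel (σ : Equiv.Perm ℤ) (x y : ℤ) :
    Equiv.swap x y * (Equiv.swap x y * σ) = σ := by
  rw [← mul_assoc, Equiv.swap_mul_self, one_mul]

/-- Exchanging `v` with its next larger value maps count `k` to count `k + 1`, respects `E`, and
multiplies the measure by `q`. The map is inverted by exchanging `v` with the rightmost larger value
on its left. -/
theorem IsMallowsLaw.measure_greaterLeftEvent_succ (hμ : IsMallowsLaw q μ) (v : ℤ) (k : ℕ)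
    {E : Set (Equiv.Perm ℤ)} (hE : MeasurableSet E) (hE' : DependsOnOrderAbove v E) :
    μ (greaterLeftEvent v (k + 1) ∩ E) = ENNReal.ofReal q * μ (greaterLeftEvent v k ∩ E) := by
  set A : ℤ → Set (Equiv.Perm ℤ) := fun y =>
    (greaterLeftEvent v k ∩ E) ∩ {σ | IsNextGreater σ v y} with hA
  have hAm : ∀ y, MeasurableSet (A y) := fun y =>
    ((measurableSet_greaterLeftEvent v k).inter hE).inter (measurableSet_isNextGreater v y)
  have hdisj : Pairwise (Function.onFun Disjoint A) := fun y z hne =>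
    Set.disjoint_left.2 fun σ h₁ h₂ => hne (IsNextGreater.unique h₁.2 h₂.2)
  have h₁ : (⋃ y, A y : Set _) =ᵐ[μ] (greaterLeftEvent v k ∩ E : Set _) := by
    rw [Filter.eventuallyEq_set]
    filter_upwards [hμ.admissible] with σ hσ
    rw [Set.mem_iUnion]
    constructor
    · rintro ⟨y, hy⟩
      exact hy.1
    · intro h
      obtain ⟨y, hy⟩ := hσ.exists_isNextGreater v
      exact ⟨y, h, hy⟩
  have h₂ : (⋃ y, {σ | Equiv.swap v y * σ ∈ A y} : Set _) =ᵐ[μ]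
      (greaterLeftEvent v (k + 1) ∩ E : Set _) := by
    rw [Filter.eventuallyEq_set]
    filter_upwards [hμ.admissible] with σ hσ
    have hnotMem : ∀ (ρ : Equiv.Perm ℤ) (y : ℤ), IsNextGreater ρ v y → y ∉ greaterLeft ρ v :=
      fun ρ y hy h => lt_asymm hy.2.1 h.2
    rw [Set.mem_iUnion]
    constructor
    · rintro ⟨y, ⟨hk, hEσ⟩, hy⟩
      replace hy : IsNextGreater (Equiv.swap v y * σ) v y := hy
      have e := hy.greaterLeft_swap_mul
      rw [swap_mul_swap_mul_cancel] at e
      refine ⟨?_, hE' _ hEσ σ fun u hu w hw => ?_⟩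
      · rw [greaterLeftEvent, Set.mem_ofPred_eq] at hk ⊢
        rw [e, Set.encard_insert_of_notMem (hnotMem _ _ hy), hk]
        rfl
      · rw [← hy.symm_swap_mul_lt_iff hu hw, swap_mul_swap_mul_cancel]
    · rintro ⟨hk, hEσ⟩
      have hne : (greaterLeft σ v).Nonempty := by
        rw [← Set.encard_ne_zero]
        rw [greaterLeftEvent, Set.mem_ofPred_eq] at hk
        rw [hk]
        simp
      obtain ⟨y, hy, hmax⟩ := Set.exists_max_image _ σ.symm (hσ.finite_greater_left v) hne
      have hnext : IsNextGreater (Equiv.swap v y * σ) v y := by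
        refine ⟨hy.1, ?_, fun u hu hlt => ?_⟩
        · simpa [symm_swap_mul_apply] using hy.2
        · simp only [symm_swap_mul_apply, Equiv.swap_apply_left, Equiv.swap_apply_right] at hlt
          by_cases huy : u = y
          · rw [huy, Equiv.swap_apply_right] at hlt
            omega
          · rw [Equiv.swap_apply_of_ne_of_ne (ne_of_gt hu) huy] at hlt
            have := hmax u ⟨hu, hlt.2⟩
            omega
      have e := hnext.greaterLeft_swap_mul
      rw [swap_mul_swap_mul_cancel] at e
      refine ⟨y, ⟨?_, hE' _ hEσ _ fun u hu w hw => ?_⟩, hnext⟩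
      · rw [greaterLeftEvent, Set.mem_ofPred_eq] at hk ⊢
        rw [e, Set.encard_insert_of_notMem (hnotMem _ _ hnext), Nat.cast_add, Nat.cast_one] at hk
        exact ENat.add_left_injective_of_ne_top ENat.one_ne_top hk
      · rw [← hnext.symm_swap_mul_lt_iff hu hw, swap_mul_swap_mul_cancel]
  rw [← measure_congr h₁, ← measure_congr h₂, measure_iUnion hdisj hAm, measure_iUnion,
    ← ENNReal.tsum_mul_left]
  · refine tsum_congr fun y => ?_
    by_cases hvy : v < y
    · exact hμ.measure_swap_mul hvy (hAm y) fun σ hσ =>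
        ⟨hσ.2.2.1, fun u hu _ => hσ.2.2.2 u hu⟩
    · have : A y = ∅ := Set.eq_empty_iff_forall_notMem.2 fun σ hσ => hvy hσ.2.1
      simp [this]
  -- Images of different pieces stay disjoint: otherwise, of `y` and `z`, both left of `v`, each
  -- would have to stand to the right of the other.
  · intro y z hyz
    rw [Function.onFun, Set.disjoint_left]
    intro σ hy hz
    have h₃ : IsNextGreater (Equiv.swap v y * σ) v y := hy.2
    have h₄ : IsNextGreater (Equiv.swap v z * σ) v z := hz.2
    obtain ⟨h₅, h₆, h₇⟩ := h₃
    obtain ⟨h₈, h₉, h₁₀⟩ := h₄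
    have e₁ := h₇ z h₈
    have e₂ := h₁₀ y h₅
    simp only [symm_swap_mul_apply, Equiv.swap_apply_left, Equiv.swap_apply_right,
      Equiv.swap_apply_of_ne_of_ne h₈.ne' hyz.symm,
      Equiv.swap_apply_of_ne_of_ne h₅.ne' hyz] at h₆ h₉ e₁ e₂
    exact hyz (σ.symm.injective (by omega))
  · exact fun y => measurable_perm_mul_left _ (hAm y)

/-- Whether `v` is a record value is independent of the relative order of the larger values. -/
theorem IsMallowsLaw.measureReal_isRecordValue_inter [IsProbabilityMeasure μ]
    (hμ : IsMallowsLaw q μ) (hq₀ : 0 ≤ q) (hq₁ : q < 1) (v : ℤ)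
    {E : Set (Equiv.Perm ℤ)} (hE : MeasurableSet E) (hE' : DependsOnOrderAbove v E) :
    μ.real ({σ | IsRecordValue σ v} ∩ E) = (1 - q) * μ.real E := by
  have hk : ∀ k, μ (greaterLeftEvent v k ∩ E) =
      ENNReal.ofReal q ^ k * μ (greaterLeftEvent v 0 ∩ E) := by
    intro k
    induction k with
    | zero => simp
    | succ k ih =>
      rw [hμ.measure_greaterLeftEvent_succ v k hE hE', ih, pow_succ]
      ring
  have hU : (⋃ k, greaterLeftEvent v k ∩ E : Set _) =ᵐ[μ] E := by
    rw [Filter.eventuallyEq_set]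
    filter_upwards [hμ.admissible] with σ hσ
    rw [Set.mem_iUnion]
    constructor
    · rintro ⟨k, hk⟩
      exact hk.2
    · intro h
      have hfin : (greaterLeft σ v).Finite := hσ.finite_greater_left v
      exact ⟨hfin.toFinset.card, hfin.encard_eq_coe_toFinset_card, h⟩
  -- The counts exhaust `E` up to a null set, and their masses form a geometric series.
  have hsum : μ E = (1 - ENNReal.ofReal q)⁻¹ * μ (greaterLeftEvent v 0 ∩ E) := by
    rw [← measure_congr hU, measure_iUnion, ← ENNReal.tsum_geometric, ← ENNReal.tsum_mul_right]
    · exact tsum_congr hk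
    · intro k l hkl
      rw [Function.onFun, Set.disjoint_left]
      intro σ h₁ h₂
      have : (k : ℕ∞) = l := h₁.1.symm.trans h₂.1
      exact hkl (by exact_mod_cast this)
    · exact fun k => (measurableSet_greaterLeftEvent v k).inter hE
  have hR : {σ | IsRecordValue σ v} = greaterLeftEvent v 0 :=
    Set.ext fun σ => mem_greaterLeftEvent_zero.symm
  have h1q : (1 - ENNReal.ofReal q) = ENNReal.ofReal (1 - q) := by
    rw [ENNReal.ofReal_sub _ hq₀, ENNReal.ofReal_one]
  rw [hR, measureReal_def, measureReal_def, hsum, ENNReal.toReal_mul, h1q, ENNReal.toReal_inv,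
    ENNReal.toReal_ofReal (by linarith), mul_inv_cancel_left₀ (by linarith)]

theorem measurableSet_recordsAgree (a : ℤ → ℤ) (x y : ℤ) :
    MeasurableSet {σ | RecordsAgree σ a x y} := by
  have : {σ | RecordsAgree σ a x y} = ⋂ u : ℤ,
      {σ | x ≤ u → u ≤ y → (IsRecordValue σ u ↔ u ∈ Set.range a)} := by
    ext σ
    simp only [RecordsAgree, Set.mem_iInter, Set.mem_ofPred_eq]
  rw [this]
  exact .iInter fun u => (MeasurableSet.const _).imp ((MeasurableSet.const _).imp
    ((measurableSet_isRecordValue u).iff (.const _)))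

theorem dependsOnOrderAbove_recordsAgree (a : ℤ → ℤ) {v x y : ℤ} (hv : v < x) :
    DependsOnOrderAbove v {σ | RecordsAgree σ a x y} := by
  intro σ hσ ρ h u hu hu'
  rw [← hσ u hu hu']
  exact forall_congr' fun w => imp_congr_right fun hw => h u (by omega) w (by omega)

open Classical in
/-- The record values form a Bernoulli process with success probability `1 - q`. -/
theorem IsMallowsLaw.measureReal_recordsAgree [IsProbabilityMeasure μ]
    (hμ : IsMallowsLaw q μ) (hq₀ : 0 ≤ q) (hq₁ : q < 1) (a : ℤ → ℤ) (x y : ℤ) :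
    μ.real {σ | RecordsAgree σ a x y} =
      ∏ u ∈ Finset.Icc x y, if u ∈ Set.range a then 1 - q else q := by
  obtain hxy | hxy := lt_or_ge y x
  · have : {σ | RecordsAgree σ a x y} = Set.univ :=
      Set.eq_univ_of_forall fun σ u h₁ h₂ => by omega
    rw [this, Finset.Icc_eq_empty (by omega)]
    simp
  -- The window grows downwards, because the record status of a value is independent of what happens
  -- above it.
  induction x, hxy using Int.leInductionDown with
  | base =>
    have hE := hμ.measureReal_isRecordValue_inter hq₀ hq₁ y .univ (fun σ _ ρ _ => trivial)
    rw [Set.inter_univ, probReal_univ, mul_one] at hE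
    have e : ∀ σ, RecordsAgree σ a y y ↔ (IsRecordValue σ y ↔ y ∈ Set.range a) := fun σ =>
      ⟨fun h => h y le_rfl le_rfl, fun h u h₁ h₂ => by rwa [le_antisymm h₂ h₁]⟩
    simp only [e, Finset.Icc_self, Finset.prod_singleton]
    split_ifs with ha
    · simpa only [ha, iff_true] using hE
    · simp only [ha, iff_false]
      rw [← Set.compl_ofPred, probReal_compl_eq_one_sub (measurableSet_isRecordValue y), hE]
      ring
  | pred x hx ih =>
    have hEm := measurableSet_recordsAgree a x y
    have hE := hμ.measureReal_isRecordValue_inter hq₀ hq₁ (x - 1) hEm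
      (dependsOnOrderAbove_recordsAgree a (by omega))
    have e : ∀ σ, RecordsAgree σ a (x - 1) y ↔
        (IsRecordValue σ (x - 1) ↔ x - 1 ∈ Set.range a) ∧ RecordsAgree σ a x y := fun σ =>
      ⟨fun h => ⟨h _ le_rfl (by omega), fun u h₁ h₂ => h u (by omega) h₂⟩, fun h u h₁ h₂ => by
        obtain rfl | h₁ := h₁.eq_or_lt
        · exact h.1
        · exact h.2 u (by omega) h₂⟩
    have hI : Finset.Icc (x - 1) y = insert (x - 1) (Finset.Icc x y) := by
      ext u
      simp only [Finset.mem_insert, Finset.mem_Icc]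
      omega
    rw [hI, Finset.prod_insert (by simp), ← ih]
    simp only [e]
    split_ifs with ha
    · simp only [ha, iff_true]
      exact hE
    · simp only [ha, iff_false]
      have := measureReal_inter_add_sdiff (μ := μ) (s := {σ | RecordsAgree σ a x y})
        (measurableSet_isRecordValue (x - 1))
      rw [Set.inter_comm, hE] at this
      have e' : {σ | ¬IsRecordValue σ (x - 1) ∧ RecordsAgree σ a x y} =
          {σ | RecordsAgree σ a x y} \ {σ | IsRecordValue σ (x - 1)} :=
        Set.ext fun σ => and_comm
      rw [e']
      linarith

open Classical in
-- The window holds one more record than gaps, hence the isolated factor `α`.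
theorem prod_Icc_strictMono {a : ℤ → ℤ} (ha : StrictMono a) (α β : ℝ) {m n : ℤ} (hmn : m ≤ n) :
    ∏ u ∈ Finset.Icc (a m) (a n), (if u ∈ Set.range a then α else β) =
      α * ∏ k ∈ Finset.Ico m n, β ^ (a (k + 1) - a k - 1).toNat * α := by
  induction n, hmn using Int.leInduction with
  | base => simp
  | succ n hn ih =>
    have h₁ : a n < a (n + 1) := ha (by omega)
    have h₂ : a m ≤ a n := ha.monotone hn
    have e : Finset.Icc (a m) (a (n + 1)) =
        insert (a (n + 1)) (Finset.Icc (a m) (a n) ∪ Finset.Ioo (a n) (a (n + 1))) := by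
      ext u
      simp only [Finset.mem_insert, Finset.mem_union, Finset.mem_Icc, Finset.mem_Ioo]
      omega
    have e' : Finset.Ico m (n + 1) = insert n (Finset.Ico m n) := by
      ext u
      simp only [Finset.mem_insert, Finset.mem_Ico]
      omega
    have hno : ∀ u ∈ Finset.Ioo (a n) (a (n + 1)), (if u ∈ Set.range a then α else β) = β := by
      intro u hu
      rw [Finset.mem_Ioo] at hu
      rw [if_neg]
      rintro ⟨k, rfl⟩
      have h₃ := ha.lt_iff_lt.1 hu.1
      have h₄ := ha.lt_iff_lt.1 hu.2
      omega
    rw [e, Finset.prod_insert, Finset.prod_union, ih, Finset.prod_congr rfl hno,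
      Finset.prod_const, Int.card_Ioo, e', Finset.prod_insert (by simp),
      if_pos (Set.mem_range_self _)]
    · ring
    · rw [Finset.disjoint_left]
      intro u hu hu'
      rw [Finset.mem_Icc] at hu
      rw [Finset.mem_Ioo] at hu'
      omega
    · simp only [Finset.mem_union, Finset.mem_Icc, Finset.mem_Ioo]
      omega

/-! ### The words between consecutive record values -/

/-- The event `E` is stable under permutations of the values strictly between `a` and `b`. -/
def StableBetween (a b : ℤ) (E : Set (Equiv.Perm ℤ)) : Prop :=
  ∀ σ ∈ E, ∀ x y, a < x → x < b → a < y → y < b → Equiv.swap x y * σ ∈ E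

theorem StableBetween.mem_iff {a b : ℤ} {E : Set (Equiv.Perm ℤ)} (hE : StableBetween a b E)
    {σ : Equiv.Perm ℤ} {x y : ℤ} (h₁ : a < x) (h₂ : x < b) (h₃ : a < y) (h₄ : y < b) :
    Equiv.swap x y * σ ∈ E ↔ σ ∈ E :=
  ⟨fun h => by simpa only [swap_mul_swap_mul_cancel] using hE _ h x y h₁ h₂ h₃ h₄,
    fun h => hE _ h x y h₁ h₂ h₃ h₄⟩

theorem StableBetween.inter {a b : ℤ} {E F : Set (Equiv.Perm ℤ)} (hE : StableBetween a b E)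
    (hF : StableBetween a b F) : StableBetween a b (E ∩ F) :=
  fun σ hσ x y h₁ h₂ h₃ h₄ => ⟨hE σ hσ.1 x y h₁ h₂ h₃ h₄, hF σ hσ.2 x y h₁ h₂ h₃ h₄⟩

theorem wordBetween_swap_mul {σ : Equiv.Perm ℤ} {a b x y : ℤ} (hx : x ≤ a ∨ b ≤ x)
    (hy : y ≤ a ∨ b ≤ y) : wordBetween (Equiv.swap x y * σ) a b = wordBetween σ a b := by
  rw [wordBetween_eq_iff]
  obtain ⟨h₁, h₂⟩ := wordBetween_eq_iff.1 (rfl : wordBetween σ a b = _)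
  refine ⟨h₁, h₂.imp_of_mem fun {u w} hu hw h => ?_⟩
  rw [h₁] at hu hw
  rw [symm_swap_mul_apply, symm_swap_mul_apply,
    Equiv.swap_apply_of_ne_of_ne (by omega) (by omega),
    Equiv.swap_apply_of_ne_of_ne (by omega) (by omega)]
  exact h

/-- The hypothesis keeps the two open intervals of integers disjoint, so the exchanged values are
outside the word. -/
theorem stableBetween_bst {a b a' b' : ℤ} (h : b ≤ a' + 1 ∨ b' ≤ a + 1) (t : Finset Word) :
    StableBetween a b {σ | bst (wordBetween σ a' b') = t} := by
  intro σ hσ x y h₁ h₂ h₃ h₄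
  rw [Set.mem_ofPred_eq, wordBetween_swap_mul (by omega) (by omega)]
  exact hσ

/-- Below a record value `b` that bounds the interval, the absence of record values strictly
between `a` and `b` means that `b` precedes all the values in between. -/
theorem forall_not_isRecordValue_iff {σ : Equiv.Perm ℤ} {a b : ℤ} (hb : IsRecordValue σ b) :
    (∀ u, a < u → u < b → ¬IsRecordValue σ u) ↔
      ∀ u, a < u → u < b → σ.symm b < σ.symm u := by
  constructor
  · by_contra! ⟨h, u₀, hu₀, hu₀', hlt₀⟩
    -- The greatest value of the gap that is not to the right of `b` would itself be a record.
    obtain ⟨u, ⟨hu, hu', hlt⟩, hmax⟩ := Int.exists_greatest_of_bdd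
      (P := fun u => a < u ∧ u < b ∧ σ.symm u ≤ σ.symm b) ⟨b, fun u hu => hu.2.1.le⟩
      ⟨u₀, hu₀, hu₀', hlt₀⟩
    refine h u hu hu' fun w hw => ?_
    obtain hwb | rfl | hwb := lt_trichotomy w b
    · by_contra! hle
      have := hmax w ⟨by omega, hwb, by omega⟩
      omega
    · exact lt_of_le_of_ne hlt fun e => hu'.ne (σ.symm.injective e)
    · exact hlt.trans_lt (hb w hwb)
  · intro h u hu hu' hrec
    exact lt_asymm (h u hu hu') (hrec b hu')

theorem isRecordValue_swap_mul {σ : Equiv.Perm ℤ} {x y u : ℤ} (hx : u < x ↔ u < y)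
    (hxu : x ≠ u) (hyu : y ≠ u) (h : IsRecordValue σ u) :
    IsRecordValue (Equiv.swap x y * σ) u := by
  intro v hv
  rw [symm_swap_mul_apply, symm_swap_mul_apply,
    Equiv.swap_apply_of_ne_of_ne hxu.symm hyu.symm]
  apply h
  simp only [Equiv.swap_apply_def]
  split_ifs <;> omega

/-- Values outside the gap keep their record status. Inside, the absence of records means that `a (k
+ 1)` precedes the whole gap, a condition symmetric in the values of the gap. -/
theorem stableBetween_recordsAgree {a : ℤ → ℤ} (ha : StrictMono a) {k m n : ℤ} (hm : m ≤ k)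
    (hn : k < n) : StableBetween (a k) (a (k + 1)) {σ | RecordsAgree σ a (a m) (a n)} := by
  intro σ hσ x y h₁ h₂ h₃ h₄
  have hno : ∀ u, a k < u → u < a (k + 1) → u ∉ Set.range a := by
    rintro _ h h' ⟨l, rfl⟩
    rw [ha.lt_iff_lt] at h h'
    omega
  have hmk := ha.monotone hm
  have hkn : a (k + 1) ≤ a n := ha.monotone (by omega)
  have hlt : a k < a (k + 1) := ha (by omega)
  have hout : ∀ u, u ≤ a k ∨ a (k + 1) ≤ u →
      (IsRecordValue (Equiv.swap x y * σ) u ↔ IsRecordValue σ u) := by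
    intro u hu
    constructor
    · intro h
      rw [← swap_mul_swap_mul_cancel σ x y]
      exact isRecordValue_swap_mul (by omega) (by omega) (by omega) h
    · exact isRecordValue_swap_mul (by omega) (by omega) (by omega)
  have hb : IsRecordValue σ (a (k + 1)) := (hσ _ (by omega) hkn).2 ⟨_, rfl⟩
  have hb' := (hout _ (Or.inr le_rfl)).2 hb
  have hin : ∀ u, a k < u → u < a (k + 1) → ¬IsRecordValue (Equiv.swap x y * σ) u := by
    rw [forall_not_isRecordValue_iff hb']
    have := (forall_not_isRecordValue_iff hb (a := a k)).1 fun u h h' hr =>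
      hno u h h' ((hσ u (by omega) (by omega)).1 hr)
    intro u h h'
    rw [symm_swap_mul_apply, symm_swap_mul_apply,
      Equiv.swap_apply_of_ne_of_ne h₂.ne' h₄.ne']
    refine this _ ?_ ?_ <;> simp only [Equiv.swap_apply_def] <;> split_ifs <;> assumption
  intro u hu hu'
  by_cases hmid : a k < u ∧ u < a (k + 1)
  · exact iff_of_false (hin u hmid.1 hmid.2) (hno u hmid.1 hmid.2)
  · rw [hout u (by omega)]
    exact hσ u hu hu'

theorem measurableSet_wordBetween_eq_shiftWord (a : ℤ) {n : ℕ} (τ : Equiv.Perm (Fin n)) :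
    MeasurableSet {σ | wordBetween σ a (a + n + 1) = shiftWord a τ} := by
  simp only [wordBetween_eq_shiftWord_iff]
  have : {σ : Equiv.Perm ℤ | ∀ i j : Fin n, i < j → σ.symm (a + (((τ i : ℕ) : ℤ) + 1)) <
      σ.symm (a + (((τ j : ℕ) : ℤ) + 1))} = ⋂ i : Fin n, ⋂ j : Fin n, {σ | i < j →
        σ.symm (a + (((τ i : ℕ) : ℤ) + 1)) < σ.symm (a + (((τ j : ℕ) : ℤ) + 1))} := by
    ext σ
    simp
  rw [this]
  exact .iInter fun i => .iInter fun j => (MeasurableSet.const _).imp (measurableSet_symm_lt _ _)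

theorem bst_wordBetween_eq (a : ℤ) (n : ℕ) (t : Finset Word) :
    {σ | bst (wordBetween σ a (a + n + 1)) = t} =
      ⋃ τ ∈ Finset.univ.filter fun τ : Equiv.Perm (Fin n) => bst (permWord τ) = t,
        {σ | wordBetween σ a (a + n + 1) = shiftWord a τ} := by
  ext σ
  simp only [Set.mem_ofPred_eq, Set.mem_iUnion, Finset.mem_filter, Finset.mem_univ, true_and,
    exists_prop]
  constructor
  · intro h
    obtain ⟨τ, hτ⟩ := exists_wordBetween_eq_shiftWord σ a n
    exact ⟨τ, by rw [← h, hτ, bst_shiftWord], hτ⟩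
  · rintro ⟨τ, rfl, hτ⟩
    rw [hτ, bst_shiftWord]

theorem measurableSet_bst_wordBetween (a : ℤ) (n : ℕ) (t : Finset Word) :
    MeasurableSet {σ | bst (wordBetween σ a (a + n + 1)) = t} := by
  rw [bst_wordBetween_eq]
  exact Finset.measurableSet_biUnion _ fun τ _ => measurableSet_wordBetween_eq_shiftWord a τ

theorem measureReal_inter_biUnion_shiftWord [IsProbabilityMeasure μ] (a : ℤ) (n : ℕ)
    {E : Set (Equiv.Perm ℤ)} (hE : MeasurableSet E) (S : Finset (Equiv.Perm (Fin n))) :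
    μ.real (E ∩ ⋃ τ ∈ S, {σ | wordBetween σ a (a + n + 1) = shiftWord a τ}) =
      ∑ τ ∈ S, μ.real (E ∩ {σ | wordBetween σ a (a + n + 1) = shiftWord a τ}) := by
  rw [Set.inter_iUnion₂, measureReal_biUnion_finset]
  · intro τ _ ρ _ hne
    rw [Function.onFun, Set.disjoint_left]
    intro σ h₁ h₂
    exact hne (shiftWord_injective a n (h₁.2.symm.trans h₂.2))
  · exact fun τ _ => hE.inter (measurableSet_wordBetween_eq_shiftWord a τ)

/-- Given an event that is stable under permutations of the values between `a` and `a + n + 1`,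
these values are arranged according to the Mallows distribution. -/
theorem IsMallowsLaw.measureReal_inter_shiftWord [IsProbabilityMeasure μ]
    (hμ : IsMallowsLaw q μ) (hq₀ : 0 ≤ q) (a : ℤ) (n : ℕ) {E : Set (Equiv.Perm ℤ)}
    (hE : MeasurableSet E) (hE' : StableBetween a (a + n + 1) E) (τ : Equiv.Perm (Fin n)) :
    μ.real (E ∩ {σ | wordBetween σ a (a + n + 1) = shiftWord a τ}) =
      μ.real E * mallowsProb q τ := by
  -- The weight of `τ` is the mass of the part of `E` where the gap is arranged by `τ`; these
  -- weights sum to the mass of `E`.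
  rw [eq_sum_mul_mallowsProb hq₀ (g := fun τ =>
      μ.real (E ∩ {σ | wordBetween σ a (a + n + 1) = shiftWord a τ})) ?_ τ,
    ← measureReal_inter_biUnion_shiftWord a n hE]
  · congr 3
    apply Set.inter_eq_left.2
    intro σ _
    simpa using exists_wordBetween_eq_shiftWord σ a n
  · intro τ i j hij hlt
    have hin : ∀ l : Fin n, a < a + (((τ l : ℕ) : ℤ) + 1) ∧
        a + (((τ l : ℕ) : ℤ) + 1) < a + n + 1 := fun l => by
      constructor <;> omega
    have hinj : ∀ l l' : Fin n, a + (((τ l : ℕ) : ℤ) + 1) = a + (((τ l' : ℕ) : ℤ) + 1) ↔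
        l = l' := fun l l' => by
      rw [← τ.injective.eq_iff, Fin.ext_iff]
      omega
    -- Neighbours in the word have no value of the gap between them in position, which is what the
    -- exchange requires.
    have h := hμ.measure_swap_mul (x := a + (((τ i : ℕ) : ℤ) + 1))
      (y := a + (((τ j : ℕ) : ℤ) + 1)) (by rw [Fin.lt_def] at hlt; omega)
      (hE.inter (measurableSet_wordBetween_eq_shiftWord a τ)) (by
        rintro σ ⟨-, hσ⟩
        rw [Set.mem_ofPred_eq, wordBetween_eq_shiftWord_iff] at hσ
        refine ⟨hσ i j (by rw [Fin.lt_def]; omega), fun u hu hu' hu'' => ?_⟩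
        have hui := hin i
        have huj := hin j
        obtain ⟨l, rfl⟩ : ∃ l, a + (((τ l : ℕ) : ℤ) + 1) = u := by
          refine ⟨τ.symm ⟨(u - a - 1).toNat, by omega⟩, ?_⟩
          rw [Equiv.apply_symm_apply]
          simp only
          omega
        obtain hl | rfl | hl := lt_trichotomy l i
        · exact lt_asymm (hσ l i hl) hu''.1
        · exact lt_irrefl _ hu
        · have : l ≠ j := by
            rintro rfl
            exact lt_irrefl _ hu'
          refine lt_asymm (hσ j l ?_) hu''.2
          rw [Fin.lt_def] at hl ⊢
          have : (l : ℕ) ≠ j := fun e => this (Fin.ext e)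
          omega)
    rw [measureReal_def, measureReal_def, ← ENNReal.toReal_ofReal hq₀, ← ENNReal.toReal_mul, ← h]
    congr 2
    ext σ
    simp only [Set.mem_inter_iff, Set.mem_ofPred_eq, wordBetween_eq_shiftWord_iff,
      symm_swap_mul_apply]
    rw [hE'.mem_iff (hin i).1 (hin i).2 (hin j).1 (hin j).2]
    refine and_congr_right fun _ => ?_
    have hsw : ∀ l : Fin n, Equiv.swap (a + (((τ i : ℕ) : ℤ) + 1)) (a + (((τ j : ℕ) : ℤ) + 1))
        (a + (((τ l : ℕ) : ℤ) + 1)) =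
          a + ((((τ * Equiv.swap i j) l : Fin n) : ℕ) : ℤ) + 1 := by
      intro l
      simp only [Equiv.Perm.mul_apply, Equiv.swap_apply_def, hinj]
      split_ifs <;> ring
    simp only [hsw, add_assoc]

theorem IsMallowsLaw.measureReal_inter_bst [IsProbabilityMeasure μ]
    (hμ : IsMallowsLaw q μ) (hq₀ : 0 ≤ q) (a : ℤ) (n : ℕ) {E : Set (Equiv.Perm ℤ)}
    (hE : MeasurableSet E) (hE' : StableBetween a (a + n + 1) E) (t : Finset Word) :
    μ.real (E ∩ {σ | bst (wordBetween σ a (a + n + 1)) = t}) =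
      μ.real E * mallowsTreeProb q n t := by
  rw [bst_wordBetween_eq, measureReal_inter_biUnion_shiftWord a n hE, mallowsTreeProb,
    Finset.mul_sum]
  exact Finset.sum_congr rfl fun τ _ => hμ.measureReal_inter_shiftWord hq₀ a n hE hE' τ

/-- Given the record values, the words between them are independent Mallows words. -/
theorem IsMallowsLaw.measureReal_recordsAgree_inter_bst [IsProbabilityMeasure μ]
    (hμ : IsMallowsLaw q μ) (hq₀ : 0 ≤ q) {a : ℤ → ℤ} {N : ℤ → ℕ}
    (ha : ∀ k, a (k + 1) = a k + N k + 1) (m n : ℤ) (t : ℤ → Finset Word)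
    {S : Finset ℤ} (hS : S ⊆ Finset.Ico m n) :
    MeasurableSet ({σ | RecordsAgree σ a (a m) (a n)} ∩
      ⋂ k ∈ S, {σ | bst (wordBetween σ (a k) (a (k + 1))) = t k}) ∧
    μ.real ({σ | RecordsAgree σ a (a m) (a n)} ∩
      ⋂ k ∈ S, {σ | bst (wordBetween σ (a k) (a (k + 1))) = t k}) =
      μ.real {σ | RecordsAgree σ a (a m) (a n)} * ∏ k ∈ S, mallowsTreeProb q (N k) (t k) := by
  have hmono : StrictMono a := strictMono_int_of_lt_succ fun k => by rw [ha]; omega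
  induction S using Finset.induction_on with
  | empty => simpa using measurableSet_recordsAgree a (a m) (a n)
  | insert k S hk ih =>
    obtain ⟨hEm, hE⟩ := ih ((Finset.subset_insert _ _).trans hS)
    have hkmn := Finset.mem_Ico.1 (hS (Finset.mem_insert_self k S))
    rw [Finset.set_biInter_insert, Set.inter_comm {σ | bst _ = t k}, ← Set.inter_assoc,
      Finset.prod_insert hk]
    -- The gaps already treated lie outside gap `k`, so the event accumulated so far is insensitive
    -- to rearrangements of that gap.
    have hst : StableBetween (a k) (a (k + 1)) ({σ | RecordsAgree σ a (a m) (a n)} ∩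
        ⋂ l ∈ S, {σ | bst (wordBetween σ (a l) (a (l + 1))) = t l}) := by
      refine (stableBetween_recordsAgree hmono hkmn.1 hkmn.2).inter ?_
      intro σ hσ x y h₁ h₂ h₃ h₄
      rw [Set.mem_iInter₂] at hσ ⊢
      intro l hl
      refine stableBetween_bst ?_ (t l) σ (hσ l hl) x y h₁ h₂ h₃ h₄
      have hne : l ≠ k := fun e => hk (e ▸ hl)
      obtain h | h := hne.lt_or_gt
      · have : a (l + 1) ≤ a k := hmono.monotone (by omega)
        omega
      · have : a (k + 1) ≤ a l := hmono.monotone (by omega)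
        omega
    rw [ha k] at hst ⊢
    refine ⟨hEm.inter (measurableSet_bst_wordBetween _ _ _), ?_⟩
    rw [hμ.measureReal_inter_bst hq₀ _ _ hEm hst, hE]
    ring

/-! ### The joint law of the trees between consecutive record values -/

/-- The enumeration `a` with `a 0 = x` and `a (k + 1) = a k + N k + 1`. -/
noncomputable def gapEnum (N : ℤ → ℕ) (x : ℤ) (k : ℤ) : ℤ :=
  x + ∑ i ∈ Finset.Ico 0 k, ((N i : ℤ) + 1) - ∑ i ∈ Finset.Ico k 0, ((N i : ℤ) + 1)

theorem gapEnum_zero (N : ℤ → ℕ) (x : ℤ) : gapEnum N x 0 = x := by simp [gapEnum]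

theorem gapEnum_succ (N : ℤ → ℕ) (x k : ℤ) : gapEnum N x (k + 1) = gapEnum N x k + N k + 1 := by
  rw [gapEnum, gapEnum]
  obtain hk | hk := le_or_gt 0 k
  · have e : Finset.Ico 0 (k + 1) = insert k (Finset.Ico 0 k) := by
      ext u
      simp only [Finset.mem_insert, Finset.mem_Ico]
      omega
    rw [e, Finset.sum_insert (by simp), Finset.Ico_eq_empty (a := k) (b := 0) (by omega),
      Finset.Ico_eq_empty (a := k + 1) (b := 0) (by omega)]
    ring
  · have e : Finset.Ico k 0 = insert k (Finset.Ico (k + 1) 0) := by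
      ext u
      simp only [Finset.mem_insert, Finset.mem_Ico]
      omega
    rw [e, Finset.sum_insert (by simp), Finset.Ico_eq_empty (a := 0) (b := k) (by omega),
      Finset.Ico_eq_empty (a := 0) (b := k + 1) (by omega)]
    ring

theorem strictMono_gapEnum (N : ℤ → ℕ) (x : ℤ) : StrictMono (gapEnum N x) :=
  strictMono_int_of_lt_succ fun k => by rw [gapEnum_succ]; omega

theorem eq_gapEnum {N : ℤ → ℕ} {V : ℤ → ℤ} {m n : ℤ}
    (h : ∀ k, m ≤ k → k < n → V (k + 1) = V k + N k + 1) (k : ℤ) (hm : m ≤ k) (hn : k ≤ n)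
    (hm₀ : m ≤ 0) (hn₀ : 0 ≤ n) : V k = gapEnum N (V 0) k := by
  obtain hk | hk := le_total 0 k
  · induction k, hk using Int.leInduction with
    | base => rw [gapEnum_zero]
    | succ k hk ih => rw [gapEnum_succ, h k (by omega) (by omega), ih (by omega) (by omega)]
  · induction k, hk using Int.leInductionDown with
    | base => rw [gapEnum_zero]
    | pred k hk ih =>
      have h₁ := ih (by omega) (by omega)
      have h₂ := h (k - 1) (by omega) (by omega)
      have h₃ := gapEnum_succ N (V 0) (k - 1)
      rw [sub_add_cancel] at h₂ h₃
      omega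

/-- The binary search tree of the word between two consecutive record values. -/
noncomputable def recordTree (σ : Equiv.Perm ℤ) (k : ℤ) : Finset Word := bst (recordWord σ k)

/-- The mass at `n` of the law of the size of the `k`-th left subtree. -/
noncomputable def sizeMass (q : ℝ) (k : ℤ) (n : ℕ) : ℝ :=
  if k = 0 then sbGeomMass (1 - q) n else geomMass (1 - q) n

/-- The mass at `t` of the law of the `k`-th left subtree. -/
noncomputable def treeMass (q : ℝ) (k : ℤ) (t : Finset Word) : ℝ :=
  sizeMass q k t.card * mallowsTreeProb q t.card t

theorem sizeMass_eq (q : ℝ) (k : ℤ) (n : ℕ) :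
    sizeMass q k n = (if k = 0 then ((n : ℝ) + 1) * (1 - q) else 1) * (q ^ n * (1 - q)) := by
  rw [sizeMass, sbGeomMass, geomMass]
  split_ifs <;> ring

theorem sizeMass_nonneg (hq₀ : 0 ≤ q) (hq₁ : q < 1) (k : ℤ) (n : ℕ) : 0 ≤ sizeMass q k n := by
  have : 0 ≤ 1 - q := by linarith
  rw [sizeMass_eq]
  split_ifs <;> positivity

/-- The record values around the cut are spaced by the sizes of the trees `t`, the largest
non-positive one being `-j`, and the words between them have the trees `t`. -/
def treesEvent (m n : ℤ) (t : ℤ → Finset Word) (j : ℕ) : Set (Equiv.Perm ℤ) :=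
  {σ | RecordsAgree σ (gapEnum (fun k => (t k).card) (-j))
      (gapEnum (fun k => (t k).card) (-j) m) (gapEnum (fun k => (t k).card) (-j) n)} ∩
    ⋂ k ∈ Finset.Ico m n, {σ | bst (wordBetween σ (gapEnum (fun k => (t k).card) (-j) k)
      (gapEnum (fun k => (t k).card) (-j) (k + 1))) = t k}

/-- Tree sizes are word lengths, so the trees fix the spacings of the record values. What remains is
the record `-j`; the bound on `j` says that the next record is positive. -/
theorem IsAdmissible.recordTree_eq_iff {σ : Equiv.Perm ℤ} (hσ : IsAdmissible σ) {m n : ℤ}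
    (hm : m ≤ 0) (hn : 1 ≤ n) (t : ℤ → Finset Word) :
    (∀ k ∈ Finset.Ico m n, recordTree σ k = t k) ↔
      σ ∈ ⋃ j ∈ Finset.range ((t 0).card + 1), treesEvent m n t j := by
  have e : ∀ k, recordTree σ k = bst (wordBetween σ (recordValue σ k) (recordValue σ (k + 1))) :=
    fun _ => rfl
  simp only [Set.mem_iUnion, exists_prop, Finset.mem_range, treesEvent, Set.mem_inter_iff,
    Set.mem_iInter, Set.mem_ofPred_eq]
  have hiff : ∀ j : ℕ, j < (t 0).card + 1 →
      ((∀ k, m ≤ k → k ≤ n → recordValue σ k = gapEnum (fun k => (t k).card) (-j) k) ↔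
        RecordsAgree σ (gapEnum (fun k => (t k).card) (-j))
          (gapEnum (fun k => (t k).card) (-j) m) (gapEnum (fun k => (t k).card) (-j) n)) := by
    intro j hj
    refine recordValue_eq_iff_recordsAgree hσ (strictMono_gapEnum _ _) ?_ ?_ hm hn
    · rw [gapEnum_zero]
      omega
    · rw [show (1 : ℤ) = 0 + 1 from rfl, gapEnum_succ, gapEnum_zero]
      omega
  constructor
  · intro h
    have hstep : ∀ k, m ≤ k → k < n →
        recordValue σ (k + 1) = recordValue σ k + (t k).card + 1 := by
      intro k hk hk'
      rw [← h k (Finset.mem_Ico.2 ⟨hk, hk'⟩), e, card_bst (nodup_wordBetween _ _ _),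
        length_wordBetween]
      have := hσ.strictMono_recordValue (show k < k + 1 by omega)
      omega
    have h₀ := hσ.recordValue_zero_le
    have h₁ := hσ.recordValue_one_pos
    have h₂ := hstep 0 hm (by omega)
    rw [zero_add] at h₂
    refine ⟨(-recordValue σ 0).toNat, by omega, ?_⟩
    have hV : ∀ k, m ≤ k → k ≤ n → recordValue σ k =
        gapEnum (fun k => (t k).card) (-((-recordValue σ 0).toNat : ℤ)) k := by
      intro k hk hk'
      rw [eq_gapEnum (N := fun k => (t k).card) hstep k hk hk' hm (by omega)]
      congr 1
      omega
    refine ⟨(hiff _ (by omega)).1 hV, fun k hk => ?_⟩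
    have hk' := Finset.mem_Ico.1 hk
    rw [← hV k hk'.1 hk'.2.le, ← hV (k + 1) (by omega) (by omega), ← e]
    exact h k hk
  · rintro ⟨j, hj, hR, hT⟩ k hk
    have hV := (hiff j hj).2 hR
    have hk' := Finset.mem_Ico.1 hk
    rw [e, hV k hk'.1 hk'.2.le, hV (k + 1) (by omega) (by omega)]
    exact hT k hk

/-- In the event for `j` there is no record strictly between `-j` and `-j + |t 0| + 1`, yet `-i`
would be one. -/
theorem disjoint_treesEvent {m n : ℤ} (hm : m ≤ 0) (hn : 1 ≤ n) (t : ℤ → Finset Word) {i j : ℕ}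
    (hij : i < j) (hj : j < (t 0).card + 1) :
    Disjoint (treesEvent m n t i) (treesEvent m n t j) := by
  rw [Set.disjoint_left]
  rintro σ ⟨hi, -⟩ ⟨hj', -⟩
  have mono := fun x => strictMono_gapEnum (fun k => (t k).card) x
  have h₀ := fun x => gapEnum_zero (fun k => (t k).card) x
  have h₁ := fun x => gapEnum_succ (fun k => (t k).card) x 0
  simp only [h₀, zero_add] at h₁
  have hm' := fun x => (mono x).monotone hm
  have hn' := fun x => (mono x).monotone hn
  have hrec : IsRecordValue σ (-(i : ℤ)) := by
    refine (hi _ ?_ ?_).2 ⟨0, h₀ _⟩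
    · exact (hm' _).trans (h₀ _).le
    · have := hn' (-(i : ℤ))
      rw [h₁] at this
      omega
  obtain ⟨l, hl⟩ := (hj' _ (by have := hm' (-(j : ℤ)); rw [h₀] at this; omega)
    (by have := hn' (-(j : ℤ)); rw [h₁] at this; omega)).1 hrec
  have hl₀ : 0 < l := (mono (-(j : ℤ))).lt_iff_lt.1 (by rw [hl, h₀]; omega)
  have hl₁ : l < 1 := (mono (-(j : ℤ))).lt_iff_lt.1 (by rw [hl, h₁]; omega)
  omega

theorem IsMallowsLaw.recordTree_joint [IsProbabilityMeasure μ]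
    (hμ : IsMallowsLaw q μ) (hq₀ : 0 ≤ q) (hq₁ : q < 1) {m n : ℤ} (hm : m ≤ 0) (hn : 1 ≤ n)
    (t : ℤ → Finset Word) :
    NullMeasurableSet {σ | ∀ k ∈ Finset.Ico m n, recordTree σ k = t k} μ ∧
    μ.real {σ | ∀ k ∈ Finset.Ico m n, recordTree σ k = t k} =
      ∏ k ∈ Finset.Ico m n, treeMass q k (t k) := by
  have hae : ({σ | ∀ k ∈ Finset.Ico m n, recordTree σ k = t k} : Set _) =ᵐ[μ]
      (⋃ j ∈ Finset.range ((t 0).card + 1), treesEvent m n t j : Set _) := by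
    rw [Filter.eventuallyEq_set]
    filter_upwards [hμ.admissible] with σ hσ using hσ.recordTree_eq_iff hm hn t
  have hj : ∀ j : ℕ, _ := fun j => hμ.measureReal_recordsAgree_inter_bst hq₀
    (fun k => gapEnum_succ (fun k => (t k).card) (-j) k) m n t (Finset.Subset.refl _)
  have hmeas : ∀ j, MeasurableSet (treesEvent m n t j) := fun j => (hj j).1
  refine ⟨(Finset.measurableSet_biUnion _ fun j _ =>
    hmeas j).nullMeasurableSet.congr hae.symm, ?_⟩
  rw [measureReal_congr hae, measureReal_biUnion_finset ?_ (fun j _ => hmeas j)]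
  -- The mass does not depend on `j`: the sum over `j` is a multiplication by `|t 0| + 1`, and the
  -- isolated factor `1 - q` completes the size-biased mass at `k = 0`.
  · have hval : ∀ j, μ.real (treesEvent m n t j) = (1 - q) * ∏ k ∈ Finset.Ico m n,
        (q ^ (t k).card * (1 - q) * mallowsTreeProb q (t k).card (t k)) := by
      intro j
      rw [treesEvent, (hj j).2, hμ.measureReal_recordsAgree hq₀ hq₁,
        prod_Icc_strictMono (strictMono_gapEnum _ _) _ _ (by omega), mul_assoc,
        ← Finset.prod_mul_distrib]
      congr 1
      refine Finset.prod_congr rfl fun k _ => ?_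
      congr 3
      rw [gapEnum_succ]
      omega
    rw [Finset.sum_congr rfl fun j _ => hval j, Finset.sum_const, Finset.card_range,
      nsmul_eq_mul]
    have hR : ∏ k ∈ Finset.Ico m n, treeMass q k (t k) =
        (∏ k ∈ Finset.Ico m n, if k = 0 then (((t k).card : ℝ) + 1) * (1 - q) else 1) *
          ∏ k ∈ Finset.Ico m n,
            (q ^ (t k).card * (1 - q) * mallowsTreeProb q (t k).card (t k)) := by
      rw [← Finset.prod_mul_distrib]
      refine Finset.prod_congr rfl fun k _ => ?_
      rw [treeMass, sizeMass_eq, mul_assoc]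
    rw [hR, Finset.prod_ite_eq', if_pos (Finset.mem_Ico.2 ⟨hm, by omega⟩)]
    push_cast
    ring
  · intro i hi j hj' hij
    rw [Finset.mem_coe, Finset.mem_range] at hi hj'
    obtain h | h := hij.lt_or_gt
    · exact disjoint_treesEvent hm hn t h hj'
    · exact (disjoint_treesEvent hm hn t h hi).symm

/-! ### The law of a Mallows tree of random size -/

instance : MeasurableSpace (Finset Word) := ⊤

instance : DiscreteMeasurableSpace (Finset Word) := ⟨fun _ => MeasurableSpace.measurableSet_top⟩

/-- The law of the binary search tree of a Mallows permutation whose size has the mass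
function `sizeMass q k`. -/
noncomputable def treeLaw (q : ℝ) (k : ℤ) : Measure (Finset Word) :=
  Measure.sum fun n : ℕ => ENNReal.ofReal (sizeMass q k n) •
    ∑ τ : Equiv.Perm (Fin n), ENNReal.ofReal (mallowsProb q τ) • Measure.dirac (bst (permWord τ))

theorem treeLaw_apply (q : ℝ) (k : ℤ) (A : Set (Finset Word)) :
    treeLaw q k A = ∑' n : ℕ, ENNReal.ofReal (sizeMass q k n) *
      ∑ τ : Equiv.Perm (Fin n), ENNReal.ofReal (mallowsProb q τ) *
        A.indicator 1 (bst (permWord τ)) := by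
  rw [treeLaw, Measure.sum_apply _ (.of_discrete)]
  simp

theorem sum_ofReal_mallowsProb (hq₀ : 0 ≤ q) (n : ℕ) :
    ∑ τ : Equiv.Perm (Fin n), ENNReal.ofReal (mallowsProb q τ) = 1 := by
  rw [← ENNReal.ofReal_sum_of_nonneg fun τ _ => mallowsProb_nonneg hq₀ τ, sum_mallowsProb hq₀,
    ENNReal.ofReal_one]

theorem treeLaw_card_eq (hq₀ : 0 ≤ q) (k : ℤ) (n : ℕ) :
    treeLaw q k {t | t.card = n} = ENNReal.ofReal (sizeMass q k n) := by
  rw [treeLaw_apply, tsum_eq_single n]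
  · simp [card_bst_permWord, sum_ofReal_mallowsProb hq₀]
  · intro m hm
    simp [card_bst_permWord, hm]

theorem treeLaw_singleton (hq₀ : 0 ≤ q) (hq₁ : q < 1) (k : ℤ) (t : Finset Word) :
    treeLaw q k {t} = ENNReal.ofReal (treeMass q k t) := by
  rw [treeLaw_apply, tsum_eq_single t.card, treeMass,
    ENNReal.ofReal_mul (sizeMass_nonneg hq₀ hq₁ _ _), mallowsTreeProb,
    ENNReal.ofReal_sum_of_nonneg fun τ _ => mallowsProb_nonneg hq₀ τ, Finset.sum_filter]
  · simp [Set.indicator_apply]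
  · intro n hn
    have : ∀ τ : Equiv.Perm (Fin n), bst (permWord τ) ≠ t := by
      rintro τ rfl
      exact hn (card_bst_permWord τ).symm
    simp [this]

theorem hasSum_sizeMass (hq₀ : 0 ≤ q) (hq₁ : q < 1) (k : ℤ) : HasSum (sizeMass q k) 1 := by
  have h1q : 1 - q ≠ 0 := by linarith
  have hg := hasSum_geometric_of_lt_one hq₀ hq₁
  have hn : ‖q‖ < 1 := by rwa [Real.norm_of_nonneg hq₀]
  have hc := hasSum_coe_mul_geometric_of_norm_lt_one hn
  have e := funext (sizeMass_eq q k)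
  by_cases hk : k = 0
  · have h := (hc.add hg).mul_right ((1 - q) ^ 2)
    have e₁ : (q / (1 - q) ^ 2 + (1 - q)⁻¹) * (1 - q) ^ 2 = 1 := by
      field_simp
      ring
    have e₂ : sizeMass q k = fun n : ℕ => ((n : ℝ) * q ^ n + q ^ n) * (1 - q) ^ 2 := by
      rw [e]
      ext n
      rw [if_pos hk]
      ring
    rwa [e₁, ← e₂] at h
  · have h := hg.mul_right (1 - q)
    have e₂ : sizeMass q k = fun n : ℕ => q ^ n * (1 - q) := by
      rw [e]
      ext n
      rw [if_neg hk, one_mul]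
    rwa [inv_mul_cancel₀ h1q, ← e₂] at h

theorem isProbabilityMeasure_treeLaw (hq₀ : 0 ≤ q) (hq₁ : q < 1) (k : ℤ) :
    IsProbabilityMeasure (treeLaw q k) := by
  refine ⟨?_⟩
  rw [treeLaw_apply]
  simp only [Set.indicator_univ, Pi.one_apply, mul_one, sum_ofReal_mallowsProb hq₀]
  have h := hasSum_sizeMass hq₀ hq₁ k
  rw [← ENNReal.ofReal_tsum_of_nonneg (sizeMass_nonneg hq₀ hq₁ k) h.summable, h.tsum_eq,
    ENNReal.ofReal_one]

theorem mallowsTreeProb_eq_zero {n : ℕ} {t : Finset Word} (ht : ¬IsBinaryTree (t : Set Word)) :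
    mallowsTreeProb q n t = 0 := by
  rw [mallowsTreeProb, Finset.sum_eq_zero]
  intro τ hτ
  rw [Finset.mem_filter] at hτ
  exact absurd (hτ.2 ▸ isBinaryTree_bst _) ht

theorem treeMass_nonneg (hq₀ : 0 ≤ q) (hq₁ : q < 1) (k : ℤ) (t : Finset Word) :
    0 ≤ treeMass q k t :=
  mul_nonneg (sizeMass_nonneg hq₀ hq₁ _ _) (Finset.sum_nonneg fun τ _ => mallowsProb_nonneg hq₀ τ)

/-! ### Independence of the trees -/

theorem aemeasurable_of_nullMeasurableSet_singleton {α β : Type*} [MeasurableSpace α]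
    {ν : Measure α} [MeasurableSpace β] [Countable β] [DiscreteMeasurableSpace β] {f : α → β}
    (h : ∀ b, NullMeasurableSet (f ⁻¹' {b}) ν) : AEMeasurable f ν := by
  apply NullMeasurable.aemeasurable
  intro s _
  rw [← Set.biUnion_preimage_singleton]
  exact .biUnion s.to_countable fun b _ => h b

/-- The space of tree tuples over a finite window is countable, so the joint mass function
determines the law. In the proof the family is extended by `∅` outside the window, where its values
are irrelevant. -/
theorem IsMallowsLaw.map_restrict_recordTree [IsProbabilityMeasure μ]
    (hμ : IsMallowsLaw q μ) (hq₀ : 0 ≤ q) (hq₁ : q < 1) {m n : ℤ} (hm : m ≤ 0) (hn : 1 ≤ n) :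
    AEMeasurable (fun σ (k : Finset.Ico m n) => recordTree σ k) μ ∧
    μ.map (fun σ (k : Finset.Ico m n) => recordTree σ k) =
      Measure.pi fun k : Finset.Ico m n => treeLaw q k := by
  have := isProbabilityMeasure_treeLaw hq₀ hq₁
  have hpre : ∀ f : Finset.Ico m n → Finset Word,
      (fun σ (k : Finset.Ico m n) => recordTree σ k) ⁻¹' {f} =
        {σ | ∀ k ∈ Finset.Ico m n, recordTree σ k =
          if h : k ∈ Finset.Ico m n then f ⟨k, h⟩ else ∅} := by
    intro f
    ext σ
    simp only [Set.mem_preimage, Set.mem_singleton_iff, funext_iff, Subtype.forall,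
      Set.mem_ofPred_eq]
    exact forall_congr' fun k => forall_congr' fun hk => by rw [dif_pos hk]
  have hae : AEMeasurable (fun σ (k : Finset.Ico m n) => recordTree σ k) μ := by
    refine aemeasurable_of_nullMeasurableSet_singleton fun f => ?_
    rw [hpre]
    exact (hμ.recordTree_joint hq₀ hq₁ hm hn _).1
  refine ⟨hae, ?_⟩
  refine Measure.ext_of_singleton fun f => ?_
  rw [Measure.map_apply_of_aemeasurable hae (measurableSet_singleton f), hpre,
    ← ofReal_measureReal, (hμ.recordTree_joint hq₀ hq₁ hm hn _).2, Measure.pi_singleton,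
    ENNReal.ofReal_prod_of_nonneg fun k _ => treeMass_nonneg hq₀ hq₁ _ _,
    ← Finset.prod_coe_sort]
  refine Finset.prod_congr rfl fun k _ => ?_
  rw [treeLaw_singleton hq₀ hq₁, dif_pos k.2]

theorem IsMallowsLaw.aemeasurable_recordTree [IsProbabilityMeasure μ]
    (hμ : IsMallowsLaw q μ) (hq₀ : 0 ≤ q) (hq₁ : q < 1) (k : ℤ) :
    AEMeasurable (fun σ => recordTree σ k) μ :=
  (measurable_pi_apply (⟨k, by rw [Finset.mem_Ico]; omega⟩ :
    Finset.Ico (min k 0) (max k 0 + 1))).comp_aemeasurable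
      (hμ.map_restrict_recordTree hq₀ hq₁ (min_le_right k 0) (by omega)).1

theorem IsMallowsLaw.map_recordTree [IsProbabilityMeasure μ]
    (hμ : IsMallowsLaw q μ) (hq₀ : 0 ≤ q) (hq₁ : q < 1) :
    μ.map (fun σ k => recordTree σ k) = Measure.infinitePi (treeLaw q) := by
  classical
  have := isProbabilityMeasure_treeLaw hq₀ hq₁
  have hae : AEMeasurable (fun σ k => recordTree σ k) μ :=
    aemeasurable_pi_iff.2 fun k => hμ.aemeasurable_recordTree hq₀ hq₁ k
  apply Measure.eq_infinitePi
  intro s A hA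
  -- The joint law is known only for windows containing the gap of the cut; surplus coordinates
  -- contribute total mass one.
  obtain ⟨m, n, hm, hn, hs⟩ : ∃ m n : ℤ, m ≤ 0 ∧ 1 ≤ n ∧ s ⊆ Finset.Ico m n := by
    obtain ⟨b, hb⟩ := s.finite_toSet.bddAbove
    obtain ⟨c, hc⟩ := s.finite_toSet.bddBelow
    refine ⟨min c 0, max b 0 + 1, by omega, by omega, fun k hk => ?_⟩
    have := hb (Finset.mem_coe.2 hk)
    have := hc (Finset.mem_coe.2 hk)
    rw [Finset.mem_Ico]
    omega
  obtain ⟨hae', hmap⟩ := hμ.map_restrict_recordTree hq₀ hq₁ hm hn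
  set B : Finset.Ico m n → Set (Finset Word) := fun k => if (k : ℤ) ∈ s then A k else Set.univ
    with hB
  have hpre : (fun σ k => recordTree σ k) ⁻¹' ((s : Set ℤ).pi A) =
      (fun σ (k : Finset.Ico m n) => recordTree σ k) ⁻¹' (Set.univ.pi B) := by
    ext σ
    simp only [Set.mem_preimage, Set.mem_pi, Finset.mem_coe, Set.mem_univ, true_imp_iff, hB,
      Subtype.forall]
    constructor
    · intro h k _
      split_ifs with hk
      · exact h k hk
      · trivial
    · intro h k hk
      simpa [hk] using h k (hs hk)
  rw [Measure.map_apply_of_aemeasurable hae (MeasurableSet.pi s.countable_toSet fun k _ => hA k),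
    hpre, ← Measure.map_apply_of_aemeasurable hae' (MeasurableSet.univ_pi fun _ => .of_discrete),
    hmap,
    Measure.pi_pi, Finset.prod_coe_sort (Finset.Ico m n)
      (fun k => treeLaw q k (if k ∈ s then A k else Set.univ)), ← Finset.prod_subset hs]
  · exact Finset.prod_congr rfl fun k hk => by rw [if_pos hk]
  · intro k _ hk
    rw [if_neg hk, measure_univ]

/-! ### The law of a Mallows spine tree -/

theorem measurable_leftSubtree (k : ℤ) : Measurable fun Y : Set Word => leftSubtree Y k :=
  measurable_set_iff.2 fun w => (measurable_set_mem w).and measurable_const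

theorem measurable_iUnion_spine :
    Measurable fun S : ℤ → Set Word => ⋃ k : ℤ, {onePow k} ∪ S k := by
  refine measurable_set_iff.2 fun w => ?_
  simp only [Set.mem_iUnion, Set.mem_union]
  exact Measurable.exists fun k =>
    measurable_const.or ((measurable_set_mem w).comp (measurable_pi_apply k))

/-- The law of the left subtree `Y(k)` as a set of words. -/
noncomputable def hangLaw (q : ℝ) (k : ℤ) : Measure (Set Word) :=
  (treeLaw q k).map fun t : Finset Word => hangLeft k (t : Set Word)

theorem hangLeft_coe_injective (k : ℤ) :
    Function.Injective fun t : Finset Word => hangLeft k (t : Set Word) :=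
  (hangLeft_injective k).comp Finset.coe_injective

theorem encard_eq_card_of_eq_hangLeft {k : ℤ} {t : Finset Word} {T : Set Word}
    (h : T = hangLeft k (t : Set Word)) : T.encard = t.card := by
  rw [h, encard_hangLeft, Set.encard_coe_eq_coe_finsetCard]

section Uniqueness

variable {Ω : Type*} [MeasurableSpace Ω] {P : Measure Ω} {Y : Ω → Set Word}

theorem IsMallowsSpineTree.measure_size (h : IsMallowsSpineTree q P Y) (k : ℤ) (n : ℕ) :
    P {ω | (leftSubtree (Y ω) k).encard = n} = ENNReal.ofReal (sizeMass q k n) := by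
  rw [sizeMass]
  split_ifs with hk
  · rw [hk]
    exact h.size_zero n
  · exact h.size_of_ne_zero k hk n

/-- A lower bound suffices, as total mass one later forces equality. Sets that are not binary trees
have zero mass on the left. -/
theorem IsMallowsSpineTree.treeLaw_singleton_le [IsProbabilityMeasure P]
    (h : IsMallowsSpineTree q P Y) (hq₀ : 0 ≤ q) (hq₁ : q < 1) (k : ℤ) (t : Finset Word) :
    treeLaw q k {t} ≤ P {ω | leftSubtree (Y ω) k = hangLeft k (t : Set Word)} := by
  rw [treeLaw_singleton hq₀ hq₁, treeMass, ENNReal.ofReal_mul (sizeMass_nonneg hq₀ hq₁ _ _)]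
  by_cases ht : IsBinaryTree (t : Set Word)
  · rw [← h.measure_size]
    by_cases h₀ : P {ω | (leftSubtree (Y ω) k).encard = t.card} = 0
    · rw [h₀, zero_mul]
      exact zero_le
    · rw [← h.cond_size k _ t ht rfl h₀, ProbabilityTheory.cond, Measure.smul_apply, smul_eq_mul,
        ← mul_assoc, ENNReal.mul_inv_cancel h₀ (measure_ne_top _ _), one_mul]
      exact Measure.restrict_le_self _
  · rw [mallowsTreeProb_eq_zero ht]
    simp

/-- The target law is carried by countably many hung finite trees and has mass one. A probability
measure that dominates it on these points dominates it everywhere, hence equals it, and no other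
subset of `𝕐` is charged. -/
theorem IsMallowsSpineTree.map_leftSubtree [IsProbabilityMeasure P]
    (h : IsMallowsSpineTree q P Y) (hq₀ : 0 ≤ q) (hq₁ : q < 1) (k : ℤ) :
    P.map (fun ω => leftSubtree (Y ω) k) = hangLaw q k := by
  have := isProbabilityMeasure_treeLaw hq₀ hq₁ k
  have hae : AEMeasurable (fun ω => leftSubtree (Y ω) k) P :=
    (measurable_leftSubtree k).comp_aemeasurable h.aemeasurable
  have : IsProbabilityMeasure (hangLaw q k) :=
    Measure.isProbabilityMeasure_map (measurable_of_countable _).aemeasurable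
  have : IsProbabilityMeasure (P.map fun ω => leftSubtree (Y ω) k) :=
    Measure.isProbabilityMeasure_map hae
  symm
  refine Measure.eq_of_le_of_measure_univ_eq (Measure.le_iff.2 fun A hA => ?_) (by simp)
  set S : Set (Finset Word) := (fun t : Finset Word => hangLeft k (t : Set Word)) ⁻¹' A
  calc hangLaw q k A = treeLaw q k (⋃ t ∈ S, {t}) := by
        rw [hangLaw, Measure.map_apply (measurable_of_countable _) hA, Set.biUnion_of_singleton]
    _ = ∑' t : S, treeLaw q k {(t : Finset Word)} := by
        rw [measure_biUnion S.to_countable (fun t _ t' _ hne => by simpa using hne)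
          fun t _ => .of_discrete]
    _ ≤ ∑' t : S, P.map (fun ω => leftSubtree (Y ω) k)
          {hangLeft k ((t : Finset Word) : Set Word)} := by
        refine ENNReal.tsum_le_tsum fun t => ?_
        rw [Measure.map_apply_of_aemeasurable hae (measurableSet_singleton _)]
        exact h.treeLaw_singleton_le hq₀ hq₁ k t
    _ = P.map (fun ω => leftSubtree (Y ω) k)
          (⋃ t ∈ S, {hangLeft k ((t : Finset Word) : Set Word)}) := by
        rw [measure_biUnion S.to_countable (fun t _ t' _ hne => ?_)
          fun t _ => measurableSet_singleton _]
        rw [Function.onFun, Set.disjoint_singleton]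
        exact fun e => hne (hangLeft_coe_injective k e)
    _ ≤ P.map (fun ω => leftSubtree (Y ω) k) A := by
        refine measure_mono (Set.iUnion₂_subset fun t ht => ?_)
        rw [Set.singleton_subset_iff]
        exact ht

/-- The law of a Mallows spine tree is determined by `q`. -/
theorem IsMallowsSpineTree.map_eq [IsProbabilityMeasure P]
    (h : IsMallowsSpineTree q P Y) (hq₀ : 0 ≤ q) (hq₁ : q < 1) :
    P.map Y = (Measure.infinitePi (hangLaw q)).map
      fun S : ℤ → Set Word => ⋃ k : ℤ, {onePow k} ∪ S k := by
  have hae : AEMeasurable (fun ω k => leftSubtree (Y ω) k) P :=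
    aemeasurable_pi_iff.2 fun k => (measurable_leftSubtree k).comp_aemeasurable h.aemeasurable
  have hY : Y =ᵐ[P] fun ω => ⋃ k : ℤ, {onePow k} ∪ leftSubtree (Y ω) k := by
    filter_upwards [h.subset_extTree, h.spine_mem] with ω h₁ h₂
      using eq_iUnion_leftSubtree h₁ h₂
  -- Independence identifies the joint law of the left subtrees as the product of their marginals.
  have hind := (iIndepFun_iff_map_fun_eq_infinitePi_map₀ hae).1 h.indep
  simp only [h.map_leftSubtree hq₀ hq₁] at hind
  rw [← hind, AEMeasurable.map_map_of_aemeasurable measurable_iUnion_spine.aemeasurable hae,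
    Measure.map_congr hY]
  rfl

end Uniqueness

/-! ### The law of the redwood tree -/

theorem redwood_eq_iUnion (σ : Equiv.Perm ℤ) :
    redwood σ = ⋃ k : ℤ, {onePow k} ∪ hangLeft k (recordTree σ k : Set Word) := rfl

theorem redwood_subset_extTree (σ : Equiv.Perm ℤ) : redwood σ ⊆ extTree :=
  Set.iUnion_mono fun _ => Set.union_subset_union_right _
    (Set.image_mono (isBinaryTree_bst _).1)

theorem onePow_mem_redwood (σ : Equiv.Perm ℤ) (k : ℤ) : onePow k ∈ redwood σ :=
  Set.mem_iUnion.2 ⟨k, Or.inl rfl⟩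

theorem IsMallowsPermutation.isMallowsSpineTree {Ω : Type*} [MeasurableSpace Ω] {P : Measure Ω}
    [IsProbabilityMeasure P] {X : Ω → Equiv.Perm ℤ} (hX : IsMallowsPermutation q P X)
    (hq₀ : 0 ≤ q) (hq₁ : q < 1) : IsMallowsSpineTree q P fun ω => redwood (X ω) := by
  have hm := hX.measurable_perm
  have hμ := hX.isMallowsLaw_map
  have hprob : IsProbabilityMeasure (P.map X) := Measure.isProbabilityMeasure_map hm.aemeasurable
  have hprob' := isProbabilityMeasure_treeLaw hq₀ hq₁
  have hZk : ∀ k, AEMeasurable (fun ω => recordTree (X ω) k) P := fun k =>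
    (hμ.aemeasurable_recordTree hq₀ hq₁ k).comp_measurable hm
  have hZ : AEMeasurable (fun ω k => recordTree (X ω) k) P := aemeasurable_pi_iff.2 hZk
  have hmap : P.map (fun ω k => recordTree (X ω) k) = Measure.infinitePi (treeLaw q) := by
    rw [← hμ.map_recordTree hq₀ hq₁, AEMeasurable.map_map_of_aemeasurable
      (aemeasurable_pi_iff.2 (hμ.aemeasurable_recordTree hq₀ hq₁)) hm.aemeasurable]
    rfl
  have hmapk : ∀ k, P.map (fun ω => recordTree (X ω) k) = treeLaw q k := fun k => by
    rw [← Measure.infinitePi_map_eval (treeLaw q) k, ← hmap,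
      AEMeasurable.map_map_of_aemeasurable (measurable_pi_apply k).aemeasurable hZ]
    rfl
  have hindep : iIndepFun (fun k ω => recordTree (X ω) k) P := by
    rw [iIndepFun_iff_map_fun_eq_infinitePi_map₀ hZ, hmap]
    simp only [hmapk]
  have hsize : ∀ (k : ℤ) (n : ℕ), P {ω | (leftSubtree (redwood (X ω)) k).encard = n} =
      ENNReal.ofReal (sizeMass q k n) := by
    intro k n
    rw [← treeLaw_card_eq hq₀, ← hmapk, Measure.map_apply_of_aemeasurable (hZk k) .of_discrete]
    congr 1
    ext ω
    simp only [leftSubtree_redwood, encard_hangLeft, Set.encard_coe_eq_coe_finsetCard,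
      Set.mem_ofPred_eq, Nat.cast_inj, Set.mem_preimage]
    rfl
  refine ⟨?_, .of_forall fun ω => redwood_subset_extTree _,
    .of_forall fun ω => onePow_mem_redwood _, ?_, fun k hk n => ?_, fun n => ?_, ?_⟩
  · simp only [redwood_eq_iUnion]
    refine measurable_iUnion_spine.comp_aemeasurable (aemeasurable_pi_iff.2 fun k => ?_)
    exact (measurable_of_countable fun t : Finset Word =>
      hangLeft k (t : Set Word)).comp_aemeasurable (hZk k)
  · simp only [leftSubtree_redwood]
    exact hindep.comp (fun k t => hangLeft k (t : Set Word)) fun k => measurable_of_countable _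
  · rw [hsize, sizeMass, if_neg hk]
  · rw [hsize, sizeMass, if_pos rfl]
  · intro k n t _ hn h₀
    -- The tree determines its size, so conditioning on the size is a mere division.
    have hsub : {ω | leftSubtree (redwood (X ω)) k = hangLeft k (t : Set Word)} ⊆
        {ω | (leftSubtree (redwood (X ω)) k).encard = n} := fun ω hω => by
      rw [Set.mem_ofPred_eq, encard_eq_card_of_eq_hangLeft hω, hn]
    have hA : P {ω | leftSubtree (redwood (X ω)) k = hangLeft k (t : Set Word)} =
        ENNReal.ofReal (treeMass q k t) := by
      rw [← treeLaw_singleton hq₀ hq₁, ← hmapk,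
        Measure.map_apply_of_aemeasurable (hZk k) .of_discrete]
      congr 1
      ext ω
      simp only [leftSubtree_redwood, Set.mem_ofPred_eq, Set.mem_preimage,
        Set.mem_singleton_iff]
      exact (hangLeft_coe_injective k).eq_iff
    rw [ProbabilityTheory.cond, Measure.smul_apply, smul_eq_mul, Measure.restrict_eq_self _ hsub,
      hA, treeMass, ENNReal.ofReal_mul (sizeMass_nonneg hq₀ hq₁ _ _), hn, ← hsize, ← mul_assoc,
      ENNReal.inv_mul_cancel h₀ (measure_ne_top _ _), one_mul]

end RedwoodMallows

theorem theorem2 {Ω : Type*} [MeasurableSpace Ω] (P : MeasureTheory.Measure Ω)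
    [MeasureTheory.IsProbabilityMeasure P] (q : ℝ) (hq0 : 0 ≤ q) (hq1 : q < 1)
    (X : Ω → Equiv.Perm ℤ) (hX : RedwoodMallows.IsMallowsPermutation q P X) :
    RedwoodMallows.IsMallowsSpineTree q P (fun ω => RedwoodMallows.redwood (X ω)) ∧
    ∀ {Ω' : Type*} [MeasurableSpace Ω'] (P' : MeasureTheory.Measure Ω')
      [MeasureTheory.IsProbabilityMeasure P'] (Y : Ω' → Set RedwoodMallows.Word),
      RedwoodMallows.IsMallowsSpineTree q P' Y →
        ProbabilityTheory.IdentDistrib Y (fun ω => RedwoodMallows.redwood (X ω)) P' P := by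
  have h := hX.isMallowsSpineTree hq0 hq1
  refine ⟨h, fun P' _ Y hY => ⟨hY.aemeasurable, h.aemeasurable, ?_⟩⟩
  -- Both laws are the image of one product measure depending only on `q`.
  rw [hY.map_eq hq0 hq1, h.map_eq hq0 hq1]
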